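/- An edge-step function is a function $f:\{1,2,\dots\}\to[0,1]$; it defines random multigraphs $G_t(f)$, $t\ge 1$, as follows. $G_1(f)$ is one vertex with one loop. Given $G_t(f)$, with probability $f(t+1)$ one adds a new vertex, joined by an edge to a vertex of $G_t(f)$ chosen with probability proportional to its degree; otherwise (with probability $1-f(t+1)$) one adds an edge between two vertices of $G_t(f)$ (a loop if they coincide), chosen independently, each with probability proportional to its degree. Degrees count loops twice, and the coins that decide between the two operations are independent. Let $f$ be a non-increasing edge-step function, and put $$b_t:=\frac13\min\left(\frac{\log t}{\log\log t},\ \frac{\log t}{-\log f(t)}\right),$$ where the second quotient is read as $0$ if $f(t)=0$ and as $+\infty$ if $f(t)=1$. Then $$\mathbb P\big(G_t(f)\text{ has only one vertex, or } \operatorname{diam}(G_t(f))\ge b_t\big)=1-o(1)\qquad(t\to\infty).$$ Moreover, if $\sum_{s}f(s)=\infty$ (i.e. the number of vertices of $G_t(f)$ tends to infinity almost surely), or $f(2)=1$, or $f(s)=0$ for some $s$, then $$\mathbb P\big(\operatorname{diam}(G_t(f))\ge b_t\big)=1-o(1)\qquad(t\to\infty).$$ -/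

import Mathlib

open Filter Topology
open scoped ENNReal

/-- A finite multigraph (loops and parallel edges allowed) with at least one edge, whose vertices
are labelled by natural numbers. The edges form a multiset of unordered pairs of vertices. -/
structure Multigraph where
  verts : Finset ℕ
  edges : Multiset (Sym2 ℕ)
  edges_ne : edges ≠ 0
  mem_verts : ∀ e ∈ edges, ∀ v ∈ e, v ∈ verts

namespace Multigraph

/-- The multiset of all endpoints of edges (each edge contributes two endpoints). -/
def endpoints (G : Multigraph) : Multiset ℕ :=
  G.edges.bind Sym2.toMultiset

/-- The degree of a vertex; a loop counts twice. -/
def degree (G : Multigraph) (v : ℕ) : ℕ :=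
  G.endpoints.count v

/-- The underlying simple graph, which has the same graph distance. -/
def toSimpleGraph (G : Multigraph) : SimpleGraph G.verts where
  Adj u v := u ≠ v ∧ s((u : ℕ), (v : ℕ)) ∈ G.edges
  symm := ⟨fun u v h => ⟨h.1.symm, by rw [Sym2.eq_swap]; exact h.2⟩⟩
  loopless := ⟨fun _ h => h.1 rfl⟩

/-- The diameter: the maximal graph distance between two vertices. -/
noncomputable def diam (G : Multigraph) : ℕ :=
  G.toSimpleGraph.diam

/-- One vertex, labelled `1`, carrying one loop. -/
def initial : Multigraph where
  verts := {1}
  edges := {s(1, 1)}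
  edges_ne := Multiset.singleton_ne_zero _
  mem_verts := by simp

/-- Add the edge `{u, v}` between existing vertices (possibly `u = v`). -/
def addEdge (G : Multigraph) (u v : G.verts) : Multigraph where
  verts := G.verts
  edges := s((u : ℕ), (v : ℕ)) ::ₘ G.edges
  edges_ne := Multiset.cons_ne_zero
  mem_verts := by
    intro e he w hw
    rcases Multiset.mem_cons.1 he with rfl | he
    · rcases Sym2.mem_iff.1 hw with rfl | rfl
      · exact u.2
      · exact v.2
    · exact G.mem_verts e he w hw

/-- Add a vertex labelled `n` together with the edge `{u, n}`. -/
def addVertex (G : Multigraph) (n : ℕ) (u : G.verts) : Multigraph where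
  verts := insert n G.verts
  edges := s((u : ℕ), n) ::ₘ G.edges
  edges_ne := Multiset.cons_ne_zero
  mem_verts := by
    intro e he w hw
    rcases Multiset.mem_cons.1 he with rfl | he
    · rcases Sym2.mem_iff.1 hw with rfl | rfl
      · exact Finset.mem_insert_of_mem u.2
      · exact Finset.mem_insert_self _ _
    · exact Finset.mem_insert_of_mem (G.mem_verts e he w hw)

theorem tsum_degree_ne_zero (G : Multigraph) :
    ∑' v : G.verts, (G.degree v : ℝ≥0∞) ≠ 0 := by
  obtain ⟨e, he⟩ := Multiset.exists_mem_of_ne_zero G.edges_ne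
  induction e with
  | _ a b =>
    have ha : a ∈ G.verts := G.mem_verts _ he a (Sym2.mem_mk_left a b)
    have hd : G.degree a ≠ 0 := by
      rw [degree, Multiset.count_ne_zero, endpoints, Multiset.mem_bind]
      exact ⟨_, he, by simp [Sym2.toMultiset]⟩
    intro h
    exact hd (by exact_mod_cast ENNReal.tsum_eq_zero.1 h ⟨a, ha⟩)

theorem tsum_degree_ne_top (G : Multigraph) :
    ∑' v : G.verts, (G.degree v : ℝ≥0∞) ≠ ∞ := by
  rw [tsum_fintype]
  exact ENNReal.sum_ne_top.2 fun v _ => ENNReal.natCast_ne_top _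

/-- The preferential attachment rule: a random vertex, chosen with probability proportional to its
degree. -/
noncomputable def attach (G : Multigraph) : PMF G.verts :=
  PMF.normalize (fun v => (G.degree v : ℝ≥0∞)) G.tsum_degree_ne_zero G.tsum_degree_ne_top

/-- The vertex-step: a new vertex, labelled `n`, is joined to a random vertex. -/
noncomputable def vertexStep (G : Multigraph) (n : ℕ) : PMF Multigraph :=
  G.attach.map fun u => G.addVertex n u

/-- The edge-step: an edge is added between two independently chosen random vertices. -/
noncomputable def edgeStep (G : Multigraph) : PMF Multigraph :=
  G.attach.bind fun u => G.attach.map fun v => G.addEdge u v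

end Multigraph

/-- A coin that shows `true` with probability `p`. -/
noncomputable def coin (p : unitInterval) : PMF Bool :=
  PMF.ofFintype (fun b => if b then ENNReal.ofReal p else ENNReal.ofReal (1 - p)) (by
    have h0 : (0 : ℝ) ≤ p := p.2.1
    have h1 : (0 : ℝ) ≤ 1 - p := sub_nonneg.2 p.2.2
    simp [← ENNReal.ofReal_add h0 h1])

/-- The law of the random multigraph `G_t(f)`, for `t ≥ 1` (the value at `t = 0` is a convention).
Given `G_t(f)`, a coin with success probability `f (t + 1)` decides whether `G_{t+1}(f)` arises by a
vertex-step, the new vertex being labelled by its time of birth `t + 1`, or by an edge-step. -/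
noncomputable def edgeStepLaw (f : ℕ → unitInterval) : ℕ → PMF Multigraph
  | 0 => PMF.pure Multigraph.initial
  | 1 => PMF.pure Multigraph.initial
  | t + 2 => (edgeStepLaw f (t + 1)).bind fun G =>
      (coin (f (t + 2))).bind fun z => if z then G.vertexStep (t + 2) else G.edgeStep

/-- The minimum of `log t / log log t` and `log t / (- log f(t))`, where the second quotient is
`0` if `f(t) = 0` and `+∞` if `f(t) = 1`. -/
noncomputable def diamScale (f : ℕ → unitInterval) (t : ℕ) : ℝ :=
  if f t = 0 then 0
  else if f t = 1 then Real.log t / Real.log (Real.log t)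
  else min (Real.log t / Real.log (Real.log t)) (Real.log t / (-Real.log (f t)))

/-! A large diameter is forced by a long pendant path, and the second moment method finds one. Put
`l = ⌈b_t⌉` and `r = t - t / 2`. A chain `a` prescribes birth times `a 0 < a 1 < …` after time `r`.
The event `PendantChain` says that `a 0` attaches outside the chain, each later vertex attaches to
its predecessor, and nothing else touches the chain. If this holds at time `t`, the last vertex of
the chain is at distance at least `l` from vertex `1` (`PendantChain.le_diam`).

On this event the degrees of the chain are deterministic, so the chance of surviving one more step
is an explicit number `persist`, and their product `chainProb` bounds the probability of the event
from below. Births cost at least `f t` each, and `1 / (2 * t)` for each attachment to a predecessor.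
Avoiding the chain costs only `exp (-O(l))`, because at most `r` steps remain after time `r`. With
one vertex in each of `l` blocks of length about `t / (2 * l)`, the expected number of chains is at
least `exp (log t - l * (-log (f t) + log l + 7))` (`exp_le_expected`), and `b_t` is chosen so that
the exponent is of order `log t`.

For the second moment, chains of the block family that share a vertex are equal or incompatible
(`PendantChain.eq_of_meet`). Disjoint chains are almost negatively correlated (`pair_le`): avoiding
both is at most as likely as under independence, and only the at most `2 * l` births need a
correction.

When `b_t ≤ 1`, connectedness suffices as soon as there are two vertices. The second claim removes
the one-vertex event, whose probability is at most a product of the factors `1 - f s`. -/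

namespace Multigraph

/-! ### Degree sums and one-step probabilities. -/

theorem mem_verts_of_mem_endpoints {G : Multigraph} {v : ℕ} (h : v ∈ G.endpoints) :
    v ∈ G.verts := by
  obtain ⟨e, he, hv⟩ := Multiset.mem_bind.1 h
  exact G.mem_verts e he v (Sym2.mem_toMultiset.1 hv)

theorem card_endpoints (G : Multigraph) : G.endpoints.card = 2 * G.edges.card := by
  simp [endpoints, Multiset.card_bind, Sym2.card_toMultiset, mul_comm]

/-- Degrees of the vertices with property `p` add up to the number of endpoints with property
`p`. -/
theorem sum_degree (G : Multigraph) (p : ℕ → Prop) [DecidablePred p] :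
    ∑ v : G.verts, (if p v then G.degree v else 0) = G.endpoints.countP p := by
  rw [Finset.univ_eq_attach, Finset.sum_attach G.verts (fun v => if p v then G.degree v else 0),
    Multiset.countP_eq_card_filter, ← Multiset.sum_count_eq_card (s := G.verts)]
  · refine Finset.sum_congr rfl fun v _ => ?_
    rw [Multiset.count_filter]
    rfl
  · intro v hv
    exact mem_verts_of_mem_endpoints (Multiset.mem_filter.1 hv).1

theorem tsum_degree (G : Multigraph) :
    ∑' v : G.verts, (G.degree v : ℝ≥0∞) = 2 * G.edges.card := by
  rw [tsum_fintype]
  have := G.sum_degree (fun _ => True)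
  simp only [if_true, Multiset.countP_True, card_endpoints] at this
  exact_mod_cast this

theorem attach_toOuterMeasure (G : Multigraph) (p : ℕ → Prop) [DecidablePred p] :
    G.attach.toOuterMeasure {u | p u} =
      ENNReal.ofReal (G.endpoints.countP p / (2 * G.edges.card)) := by
  have hpos : (0 : ℝ) < 2 * G.edges.card := by
    have : 0 < G.edges.card := Multiset.card_pos.2 G.edges_ne
    positivity
  rw [PMF.toOuterMeasure_apply_fintype, ← G.sum_degree p, ENNReal.ofReal_div_of_pos hpos]
  have h2 : ENNReal.ofReal (2 * (G.edges.card : ℝ)) = 2 * G.edges.card := by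
    rw [ENNReal.ofReal_mul (by norm_num)]; simp
  rw [h2, ENNReal.ofReal_natCast, Nat.cast_sum, ENNReal.div_eq_inv_mul, Finset.mul_sum]
  refine Finset.sum_congr rfl fun v _ => ?_
  by_cases h : p v
  · simp [Set.indicator, h, attach, PMF.normalize_apply, -tsum_fintype, tsum_degree, mul_comm]
  · simp [Set.indicator, h]

/-- The transition kernel from time `s` to time `s + 1`, if a vertex-step has probability `p`. -/
noncomputable def step (p : unitInterval) (n : ℕ) (G : Multigraph) : PMF Multigraph :=
  (coin p).bind fun z => if z then G.vertexStep n else G.edgeStep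

theorem step_toOuterMeasure (p : unitInterval) (n : ℕ) (G : Multigraph) (S : Set Multigraph) :
    (G.step p n).toOuterMeasure S =
      ENNReal.ofReal p * G.attach.toOuterMeasure {u | G.addVertex n u ∈ S} +
      ENNReal.ofReal (1 - p) *
        ∑' u, G.attach u * G.attach.toOuterMeasure {v | G.addEdge u v ∈ S} := by
  rw [step, PMF.toOuterMeasure_bind_apply, tsum_fintype, Fintype.sum_bool]
  simp [coin, vertexStep, edgeStep, PMF.toOuterMeasure_bind_apply, PMF.toOuterMeasure_map_apply,
    Set.preimage]

/-- If an edge-step leads to `S` only if both endpoints satisfy `q`, then it does so with probability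
at most the square of the probability of `q`. -/
theorem tsum_attach_le (G : Multigraph) (q : ℕ → Prop) [DecidablePred q] (S : Set Multigraph)
    (h : ∀ u v : G.verts, G.addEdge u v ∈ S → q u ∧ q v) :
    ∑' u, G.attach u * G.attach.toOuterMeasure {v | G.addEdge u v ∈ S} ≤
      G.attach.toOuterMeasure {u | q u} * G.attach.toOuterMeasure {u | q u} := by
  rw [PMF.toOuterMeasure_apply G.attach {u | q u}, ← ENNReal.tsum_mul_right,
    ← PMF.toOuterMeasure_apply]
  refine ENNReal.tsum_le_tsum fun u => ?_
  by_cases hu : q u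
  · rw [Set.indicator_of_mem (by exact hu)]
    refine mul_le_mul_right (MeasureTheory.measure_mono fun v hv => (h u v hv).2) _
  · have : {v | G.addEdge u v ∈ S} = ∅ := by
      ext v; simpa using fun hv => hu (h u v hv).1
    simp [this]

theorem le_tsum_attach (G : Multigraph) (q : ℕ → Prop) [DecidablePred q] (S : Set Multigraph)
    (h : ∀ u v : G.verts, q u → q v → G.addEdge u v ∈ S) :
    G.attach.toOuterMeasure {u | q u} * G.attach.toOuterMeasure {u | q u} ≤
      ∑' u, G.attach u * G.attach.toOuterMeasure {v | G.addEdge u v ∈ S} := by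
  rw [PMF.toOuterMeasure_apply G.attach {u | q u}, ← ENNReal.tsum_mul_right,
    ← PMF.toOuterMeasure_apply]
  refine ENNReal.tsum_le_tsum fun u => ?_
  by_cases hu : q u
  · rw [Set.indicator_of_mem (by exact hu)]
    refine mul_le_mul_right (MeasureTheory.measure_mono fun v hv => h u v hu hv) _
  · simp [hu]

/-! ### Almost sure structure of the random graph. -/

/-- Properties that `G_s` has almost surely. -/
structure Valid (s : ℕ) (G : Multigraph) : Prop where
  card_edges : G.edges.card = s
  one_mem : 1 ∈ G.verts
  mem_Icc : ∀ v ∈ G.verts, 1 ≤ v ∧ v ≤ s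
  exists_sup : ∀ v ∈ G.verts, ∃ e ∈ G.edges, e.sup = v
  connected : G.toSimpleGraph.Connected

theorem valid_initial : Valid 1 initial where
  card_edges := by simp [initial]
  one_mem := by simp [initial]
  mem_Icc := by simp [initial]
  exists_sup := by simp [initial]
  connected := by
    have : Subsingleton initial.verts := ⟨fun a b => by
      have ha := a.2; have hb := b.2
      simp only [initial, Finset.mem_singleton] at ha hb
      exact Subtype.ext (ha.trans hb.symm)⟩
    have : Nonempty initial.verts := ⟨⟨1, by simp [initial]⟩⟩
    exact ⟨SimpleGraph.Preconnected.of_subsingleton⟩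

theorem Valid.addEdge {s : ℕ} {G : Multigraph} (h : Valid s G) (u v : G.verts) :
    Valid (s + 1) (G.addEdge u v) where
  card_edges := by simp [Multigraph.addEdge, h.card_edges]
  one_mem := h.one_mem
  mem_Icc := fun w hw => ⟨(h.mem_Icc w hw).1, (h.mem_Icc w hw).2.trans (Nat.le_succ s)⟩
  exists_sup := fun w hw => by
    obtain ⟨e, he, hs⟩ := h.exists_sup w hw
    exact ⟨e, Multiset.mem_cons_of_mem he, hs⟩
  connected := by
    refine h.connected.mono (G' := (G.addEdge u v).toSimpleGraph) fun a b hab => ?_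
    exact ⟨hab.1, Multiset.mem_cons_of_mem hab.2⟩

theorem Valid.addVertex {s : ℕ} {G : Multigraph} (h : Valid s G) (u : G.verts) :
    Valid (s + 1) (G.addVertex (s + 1) u) where
  card_edges := by simp [Multigraph.addVertex, h.card_edges]
  one_mem := Finset.mem_insert_of_mem h.one_mem
  mem_Icc := fun w hw => by
    rcases Finset.mem_insert.1 hw with rfl | hw
    · omega
    · exact ⟨(h.mem_Icc w hw).1, (h.mem_Icc w hw).2.trans (Nat.le_succ s)⟩
  exists_sup := fun w hw => by
    rcases Finset.mem_insert.1 hw with rfl | hw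
    · refine ⟨s((u : ℕ), s + 1), Multiset.mem_cons_self _ _, ?_⟩
      have := (h.mem_Icc u u.2).2
      simp; omega
    · obtain ⟨e, he, hs⟩ := h.exists_sup w hw
      exact ⟨e, Multiset.mem_cons_of_mem he, hs⟩
  connected := by
    set G' := G.addVertex (s + 1) u with hG'
    let φ : G.toSimpleGraph →g G'.toSimpleGraph :=
      { toFun := fun a => ⟨a, Finset.mem_insert_of_mem a.2⟩
        map_rel' := fun {a b} hab =>
          ⟨fun h => hab.1 (Subtype.ext (Subtype.mk.inj h)), Multiset.mem_cons_of_mem hab.2⟩ }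
    have key : ∀ a : G'.verts, G'.toSimpleGraph.Reachable (φ u) a := by
      rintro ⟨a, ha⟩
      rcases Finset.mem_insert.1 ha with rfl | ha'
      · refine SimpleGraph.Adj.reachable ⟨?_, Multiset.mem_cons_self _ _⟩
        intro hu
        have h1 : (u : ℕ) = s + 1 := congrArg Subtype.val hu
        have := (h.mem_Icc u u.2).2
        omega
      · exact (h.connected.preconnected u ⟨a, ha'⟩).map φ
    have : Nonempty G'.verts := ⟨φ u⟩
    exact ⟨fun a b => (key a).symm.trans (key b)⟩

theorem mem_support_step {p : unitInterval} {n : ℕ} {G G' : Multigraph}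
    (h : G' ∈ (G.step p n).support) :
    (∃ u, G' = G.addVertex n u) ∨ ∃ u v, G' = G.addEdge u v := by
  rw [step, PMF.mem_support_bind_iff] at h
  obtain ⟨z, -, hz⟩ := h
  cases z
  · right
    simp only [edgeStep, Bool.false_eq_true, if_false, PMF.mem_support_bind_iff,
      PMF.mem_support_map_iff] at hz
    obtain ⟨u, -, v, -, rfl⟩ := hz
    exact ⟨u, v, rfl⟩
  · left
    simp only [vertexStep, if_true, PMF.mem_support_map_iff] at hz
    obtain ⟨u, -, rfl⟩ := hz
    exact ⟨u, rfl⟩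

end Multigraph

open Multigraph

theorem edgeStepLaw_succ (f : ℕ → unitInterval) {s : ℕ} (hs : 1 ≤ s) :
    edgeStepLaw f (s + 1) = (edgeStepLaw f s).bind (Multigraph.step (f (s + 1)) (s + 1)) := by
  obtain ⟨s, rfl⟩ := Nat.exists_eq_add_of_le' hs
  rfl

theorem valid_of_mem_support (f : ℕ → unitInterval) {s : ℕ} (hs : 1 ≤ s) :
    ∀ G ∈ (edgeStepLaw f s).support, Valid s G := by
  induction s, hs using Nat.le_induction with
  | base =>
    intro G hG
    rw [edgeStepLaw, PMF.mem_support_pure_iff] at hG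
    exact hG ▸ valid_initial
  | succ s hs ih =>
    intro G hG
    rw [edgeStepLaw_succ f hs, PMF.mem_support_bind_iff] at hG
    obtain ⟨G₀, h₀, hG⟩ := hG
    rcases mem_support_step hG with ⟨u, rfl⟩ | ⟨u, v, rfl⟩
    · exact (ih G₀ h₀).addVertex u
    · exact (ih G₀ h₀).addEdge u v

/-- Lower bound for the probability of an event after one step. -/
theorem PMF.mul_le_toOuterMeasure_bind {α β : Type*} (p : PMF α) (k : α → PMF β) (S : Set α)
    (T : Set β) (c : ℝ≥0∞) (h : ∀ a ∈ p.support, a ∈ S → c ≤ (k a).toOuterMeasure T) :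
    p.toOuterMeasure S * c ≤ (p.bind k).toOuterMeasure T := by
  rw [PMF.toOuterMeasure_bind_apply, PMF.toOuterMeasure_apply, ← ENNReal.tsum_mul_right]
  refine ENNReal.tsum_le_tsum fun a => ?_
  by_cases ha : a ∈ S
  · by_cases hp : a ∈ p.support
    · rw [Set.indicator_of_mem ha]
      gcongr
      exact h a hp ha
    · have : p a = 0 := (p.apply_eq_zero_iff a).2 hp
      simp [Set.indicator, this]
  · simp [ha]

/-- Upper bound for the probability of an event after one step. -/
theorem PMF.toOuterMeasure_bind_le {α β : Type*} (p : PMF α) (k : α → PMF β) (S : Set α)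
    (T : Set β) (c : ℝ≥0∞) (h : ∀ a ∈ p.support, a ∈ S → (k a).toOuterMeasure T ≤ c)
    (h0 : ∀ a ∈ p.support, ∀ b ∈ (k a).support, b ∈ T → a ∈ S) :
    (p.bind k).toOuterMeasure T ≤ p.toOuterMeasure S * c := by
  rw [PMF.toOuterMeasure_bind_apply, PMF.toOuterMeasure_apply, ← ENNReal.tsum_mul_right]
  refine ENNReal.tsum_le_tsum fun a => ?_
  by_cases hp : a ∈ p.support
  · by_cases ha : a ∈ S
    · rw [Set.indicator_of_mem ha]
      gcongr
      exact h a hp ha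
    · have : (k a).toOuterMeasure T = 0 := by
        rw [PMF.toOuterMeasure_apply_eq_zero_iff, Set.disjoint_left]
        exact fun b hb hT => ha (h0 a hp b hb hT)
      simp [this]
  · have : p a = 0 := (p.apply_eq_zero_iff a).2 hp
    simp [this]

/-! ### Pendant chains and how they evolve in one step. -/

namespace Multigraph

variable {l : ℕ}

/-- The larger endpoint of `e` belongs to the chain `a`, and the smaller one is the preceding
vertex of the chain, or lies outside the chain if there is no preceding vertex. -/
def Fits (a : Fin l → ℕ) (e : Sym2 ℕ) : Prop :=
  ∃ j, e.sup = a j ∧ (((j : ℕ) = 0 ∧ ∀ k, e.inf ≠ a k) ∨ ∃ k : Fin l, (k : ℕ) + 1 = j ∧ e.inf = a k)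

/-- The degree of the `i`-th vertex of a pendant chain at time `s`. -/
def chainDeg (a : Fin l → ℕ) (s : ℕ) (i : Fin l) : ℕ :=
  (if a i ≤ s then 1 else 0) + if ∃ j : Fin l, (i : ℕ) + 1 = j ∧ a j ≤ s then 1 else 0

/-- The part of the chain `a` that is born by time `s` forms a pendant path of `G`: the vertices
`a 0, a 1, …` are born one from another, and no other edges touch them. -/
structure PendantChain (a : Fin l → ℕ) (s : ℕ) (G : Multigraph) : Prop where
  count_sup : ∀ i, a i ≤ s → G.edges.countP (fun e => e.sup = a i) = 1
  fits : ∀ e ∈ G.edges, ∀ i, a i ∈ e → Fits a e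
  degree_eq : ∀ i, G.degree (a i) = chainDeg a s i

/-- The condition on the edge born at time `s + 1` under which a pendant chain persists. -/
def Extends (a : Fin l → ℕ) (s : ℕ) (e : Sym2 ℕ) : Prop :=
  ((∀ i, a i ≠ s + 1) ∧ ∀ i, a i ∉ e) ∨ (e.sup = s + 1 ∧ (∃ i, a i = s + 1) ∧ Fits a e)

theorem sup_mem (e : Sym2 ℕ) : e.sup ∈ e := by
  induction e with
  | _ x y => rcases le_total x y with h | h <;> simp [h]

theorem toMultiset_eq (e : Sym2 ℕ) : e.toMultiset = {e.inf, e.sup} := by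
  induction e with
  | _ x y =>
    rcases le_total x y with h | h
    · rw [Sym2.inf_mk, Sym2.sup_mk, inf_eq_left.2 h, sup_eq_right.2 h]; rfl
    · rw [Sym2.inf_mk, Sym2.sup_mk, inf_eq_right.2 h, sup_eq_left.2 h, Multiset.pair_comm]; rfl

theorem Extends.sup_ne {a : Fin l → ℕ} {s : ℕ} {e : Sym2 ℕ} (h : Extends a s e) {i : Fin l}
    (hi : a i ≤ s) : e.sup ≠ a i := by
  rcases h with h | h
  · exact fun he => h.2 i (he ▸ sup_mem e)
  · have := h.1
    omega

/-- An edge that avoids the chain changes no degree in it. The birth edge of `a j` adds one to the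
degree of `a j`, and one to that of its predecessor if there is one. -/
theorem Extends.chainDeg_succ {a : Fin l → ℕ} (ha : StrictMono a) {s : ℕ} {e : Sym2 ℕ}
    (h : Extends a s e) (i : Fin l) :
    e.toMultiset.count (a i) + chainDeg a s i = chainDeg a (s + 1) i := by
  have hle : ∀ j : Fin l, a j ≠ s + 1 → (a j ≤ s + 1 ↔ a j ≤ s) := fun j hj => by omega
  rcases h with ⟨h1, h2⟩ | ⟨h1, -, j, hj, h3⟩
  · rw [Multiset.count_eq_zero_of_notMem (by simpa using h2 i)]
    simp only [chainDeg, hle _ (h1 _), zero_add]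
  · rw [toMultiset_eq, Multiset.insert_eq_cons, Multiset.count_cons, Multiset.count_singleton]
    have hj1 : a j = s + 1 := hj ▸ h1
    have hA : (a i = e.sup) ↔ i = j := by rw [hj]; exact ha.injective.eq_iff
    have hA' : (if a i ≤ s + 1 then 1 else 0) = (if a i ≤ s then 1 else 0) + if i = j then 1 else 0 := by
      by_cases hij : i = j
      · subst hij; simp [hj1]
      · have : a i ≠ s + 1 := fun h => hij (ha.injective (h.trans hj1.symm))
        simp [hle i this, hij]
    have hB : (a i = e.inf) ↔ (i : ℕ) + 1 = j := by
      rcases h3 with ⟨h0, h3⟩ | ⟨k, hk, h3⟩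
      · exact ⟨fun h => absurd h.symm (h3 i), fun h => by omega⟩
      · rw [h3, ha.injective.eq_iff, Fin.ext_iff]; omega
    have hB' : (if ∃ j : Fin l, (i : ℕ) + 1 = j ∧ a j ≤ s + 1 then 1 else 0) =
        (if ∃ j : Fin l, (i : ℕ) + 1 = j ∧ a j ≤ s then 1 else 0) +
          if (i : ℕ) + 1 = j then 1 else 0 := by
      by_cases hij : (i : ℕ) + 1 = j
      · have h4 : ∃ j : Fin l, (i : ℕ) + 1 = j ∧ a j ≤ s + 1 := ⟨j, hij, hj1.le⟩
        have h5 : ¬ ∃ j : Fin l, (i : ℕ) + 1 = j ∧ a j ≤ s := by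
          rintro ⟨j', h6, h7⟩
          have : j' = j := Fin.ext (h6.symm.trans hij)
          subst this; omega
        rw [if_pos h4, if_neg h5, if_pos hij]
      · have h4 : (∃ j : Fin l, (i : ℕ) + 1 = j ∧ a j ≤ s + 1) ↔
            ∃ j : Fin l, (i : ℕ) + 1 = j ∧ a j ≤ s := by
          refine exists_congr fun j' => and_congr_right fun h6 => hle j' fun h7 => hij ?_
          rw [ha.injective (h7.trans hj1.symm)] at h6
          exact h6
        simp only [h4, hij, if_false, add_zero]
    simp only [chainDeg, hA', hB', hA, hB]
    ring

/-- How a pendant chain evolves when the edge `e` is added to the graph. -/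
theorem pendantChain_succ_iff {a : Fin l → ℕ} (ha : StrictMono a) {s : ℕ} {G G' : Multigraph}
    (hG : Valid s G) {u x : ℕ} (hu : u ∈ G.verts) (hx : x ∈ G.verts ∨ x = s + 1)
    (hE : G'.edges = s(u, x) ::ₘ G.edges) :
    PendantChain a (s + 1) G' ↔ PendantChain a s G ∧ Extends a s s(u, x) := by
  set e := s(u, x) with he
  have hus := (hG.mem_Icc u hu).2
  have hcount : ∀ v, G'.edges.countP (fun e => e.sup = v) =
      G.edges.countP (fun e => e.sup = v) + if e.sup = v then 1 else 0 := fun v => by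
    rw [hE, Multiset.countP_cons]
  have hdeg : ∀ v, G'.degree v = e.toMultiset.count v + G.degree v := fun v => by
    rw [degree, endpoints, hE, Multiset.cons_bind, Multiset.count_add]; rfl
  have hsupG : ∀ e' ∈ G.edges, e'.sup ≤ s := fun e' he' =>
    (hG.mem_Icc _ (G.mem_verts e' he' _ (sup_mem e'))).2
  constructor
  · intro H
    have hExt : Extends a s e := by
      rcases hx with hx | hx
      · have hev : e.sup ∈ G.verts := by
          rcases le_total u x with h | h <;> simp [he, h, hx, hu]
        left
        constructor
        · intro i hi
          have h1 := H.count_sup i hi.le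
          have h2 : 0 < G'.edges.countP (fun e => e.sup = a i) := by omega
          obtain ⟨e', he', h3⟩ := Multiset.countP_pos.1 h2
          rw [hE, Multiset.mem_cons] at he'
          rcases he' with rfl | he'
          · have := (hG.mem_Icc _ hev).2
            omega
          · have := hsupG e' he'
            omega
        · intro i hi
          -- If the new edge between old vertices touched the chain, its larger endpoint would be a
          -- chain vertex `a j`. That vertex already has its birth edge, so two edges would have `a
          -- j` as larger endpoint, against `count_sup`.
          obtain ⟨j, hj, -⟩ := H.fits e (hE ▸ Multiset.mem_cons_self _ _) i hi
          have h1 := H.count_sup j (by rw [← hj]; exact (hG.mem_Icc _ hev).2.trans s.le_succ)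
          rw [hcount, if_pos hj] at h1
          obtain ⟨e', he', h3⟩ := hG.exists_sup _ hev
          have : 0 < G.edges.countP (fun e => e.sup = a j) :=
            Multiset.countP_pos.2 ⟨e', he', h3.trans hj⟩
          omega
      · have hsup : e.sup = s + 1 := by simp [he, hx]; omega
        by_cases hi : ∃ i, a i = s + 1
        · obtain ⟨i, hi⟩ := hi
          exact Or.inr ⟨hsup, ⟨i, hi⟩, H.fits e (hE ▸ Multiset.mem_cons_self _ _) i
            (by rw [hi, ← hsup]; exact sup_mem e)⟩
        · refine Or.inl ⟨fun i h => hi ⟨i, h⟩, fun i h => hi ?_⟩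
          obtain ⟨j, hj, -⟩ := H.fits e (hE ▸ Multiset.mem_cons_self _ _) i h
          exact ⟨j, hj.symm.trans hsup⟩
    refine ⟨⟨fun i hi => ?_, fun e' he' => H.fits e' (hE ▸ Multiset.mem_cons_of_mem he'),
      fun i => ?_⟩, hExt⟩
    · have := H.count_sup i (hi.trans s.le_succ)
      rwa [hcount, if_neg (hExt.sup_ne hi), add_zero] at this
    · have h1 := hExt.chainDeg_succ ha i
      have h2 := H.degree_eq i
      rw [hdeg] at h2
      omega
  · rintro ⟨H, hExt⟩
    refine ⟨fun i hi => ?_, fun e' he' i hi => ?_, fun i => ?_⟩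
    · rw [hcount]
      by_cases his : a i ≤ s
      · rw [if_neg (hExt.sup_ne his), H.count_sup i his]
      · have his : a i = s + 1 := by omega
        have h0 : G.edges.countP (fun e => e.sup = a i) = 0 :=
          Multiset.countP_eq_zero.2 fun e' he' h => by have := hsupG e' he'; omega
        rcases hExt with h | h
        · exact absurd his (h.1 i)
        · rw [h0, if_pos (h.1.trans his.symm)]
    · rw [hE, Multiset.mem_cons] at he'
      rcases he' with rfl | he'
      · rcases hExt with h | h
        · exact absurd hi (h.2 i)
        · exact h.2.2
      · exact H.fits e' he' i hi
    · rw [hdeg, H.degree_eq, hExt.chainDeg_succ ha]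

theorem pendantChain_addVertex_iff {a : Fin l → ℕ} (ha : StrictMono a) {s : ℕ} {G : Multigraph}
    (hG : Valid s G) (u : G.verts) :
    PendantChain a (s + 1) (G.addVertex (s + 1) u) ↔
      PendantChain a s G ∧ Extends a s s((u : ℕ), s + 1) :=
  pendantChain_succ_iff ha hG u.2 (Or.inr rfl) rfl

theorem pendantChain_addEdge_iff {a : Fin l → ℕ} (ha : StrictMono a) {s : ℕ} {G : Multigraph}
    (hG : Valid s G) (u v : G.verts) :
    PendantChain a (s + 1) (G.addEdge u v) ↔
      PendantChain a s G ∧ Extends a s s((u : ℕ), (v : ℕ)) :=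
  pendantChain_succ_iff ha hG u.2 (Or.inl v.2) rfl

theorem extends_addEdge_iff {a : Fin l → ℕ} {s u v : ℕ} (hu : u ≤ s) (hv : v ≤ s) :
    Extends a s s(u, v) ↔ (∀ i, a i ≠ s + 1) ∧ (¬ ∃ i, a i = u) ∧ ¬ ∃ i, a i = v := by
  have : ¬ (s(u, v).sup = s + 1) := by
    simp; omega
  simp only [Extends, this, false_and, or_false, Sym2.mem_iff, not_or, forall_and, not_exists]

/-- A new vertex that is not part of the chain has to avoid the chain. -/
theorem extends_addVertex_iff_of_ne {a : Fin l → ℕ} {s u : ℕ} (h : ∀ i, a i ≠ s + 1) :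
    Extends a s s(u, s + 1) ↔ ¬ ∃ i, a i = u := by
  have : ¬ ∃ i, a i = s + 1 := by simpa using h
  simp [Extends, h]

theorem extends_addVertex_iff_of_eq {a : Fin l → ℕ} (ha : StrictMono a) {s u : ℕ} (hu : u ≤ s)
    {i : Fin l} (hi : a i = s + 1) :
    Extends a s s(u, s + 1) ↔
      ((i : ℕ) = 0 ∧ ¬ ∃ k, a k = u) ∨ ∃ k : Fin l, (k : ℕ) + 1 = i ∧ u = a k := by
  have hsup : s(u, s + 1).sup = s + 1 := by simp; omega
  have hinf : s(u, s + 1).inf = u := by simp; omega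
  have h1 : ¬ ∀ i, a i ≠ s + 1 := fun h => h i hi
  simp only [Extends, h1, hsup, false_and, false_or, true_and, Fits, hinf]
  constructor
  · rintro ⟨-, j, hj, h⟩
    have : j = i := ha.injective (hj.symm.trans hi.symm)
    subst this
    rcases h with h | h
    · exact Or.inl ⟨h.1, fun ⟨k, hk⟩ => h.2 k hk.symm⟩
    · exact Or.inr h
  · intro h
    refine ⟨⟨i, hi⟩, i, hi.symm, ?_⟩
    rcases h with h | h
    · exact Or.inl ⟨h.1, fun k hk => h.2 ⟨k, hk.symm⟩⟩
    · exact Or.inr h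

/-! ### Probability that chains survive one step. -/

/-- The total degree of a pendant chain at time `s`. -/
def chainDegSum (a : Fin l → ℕ) (s : ℕ) : ℕ := ∑ i, chainDeg a s i

theorem chainDegSum_le (a : Fin l → ℕ) (s : ℕ) : chainDegSum a s ≤ 2 * l := by
  have : ∀ i ∈ Finset.univ, chainDeg a s i ≤ 2 := fun i _ => by
    unfold chainDeg; split_ifs <;> omega
  calc chainDegSum a s ≤ Finset.univ.card • 2 := Finset.sum_le_card_nsmul _ _ _ this
    _ = 2 * l := by simp [mul_comm]

theorem PendantChain.countP_endpoints {a : Fin l → ℕ} (ha : StrictMono a) {s : ℕ}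
    {G : Multigraph} (h : PendantChain a s G) :
    G.endpoints.countP (fun v => ∃ i, a i = v) = chainDegSum a s := by
  rw [Multiset.countP_eq_card_filter,
    ← Multiset.sum_count_eq_card (s := Finset.univ.image a)
      (fun v hv => by simpa using (Multiset.mem_filter.1 hv).2),
    Finset.sum_image ha.injective.injOn]
  refine Finset.sum_congr rfl fun i _ => ?_
  rw [Multiset.count_filter, if_pos ⟨i, rfl⟩, ← h.degree_eq i]
  rfl

theorem _root_.Multiset.countP_add_countP_add_countP {α : Type*} (p q : α → Prop)
    [DecidablePred p] [DecidablePred q] (hpq : ∀ v, p v → ¬ q v) (M : Multiset α) :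
    M.countP p + M.countP q + M.countP (fun v => ¬ p v ∧ ¬ q v) = M.card := by
  induction M using Multiset.induction_on with
  | empty => simp
  | cons v M ih =>
    simp only [Multiset.countP_cons, Multiset.card_cons]
    have := hpq v
    by_cases hp : p v
    · simp only [hp, if_true, this hp, not_true, false_and, if_false]; omega
    · by_cases hq : q v
      · simp only [hp, hq, if_true, not_true, and_false, if_false]; omega
      · simp only [hp, hq, not_false_eq_true, and_self, if_true, if_false]; omega

/-- The probability that a random vertex does not belong to a pendant chain. -/
noncomputable def avoid (a : Fin l → ℕ) (s : ℕ) : ℝ := 1 - chainDegSum a s / (2 * s)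

/-- The chain occupies exactly `chainDegSum a s` of the `2 * s` endpoints, whatever the rest of the
graph looks like, so the probability depends on `a` and `s` only. -/
theorem PendantChain.attach_avoid {a : Fin l → ℕ} (ha : StrictMono a) {s : ℕ} (hs : 1 ≤ s)
    {G : Multigraph} (hG : Valid s G) (h : PendantChain a s G) :
    G.attach.toOuterMeasure {u | ¬ ∃ i, a i = u} = ENNReal.ofReal (avoid a s) ∧ 0 ≤ avoid a s := by
  have h1 := Multiset.card_eq_countP_add_countP (fun v => ∃ i, a i = v) G.endpoints
  rw [h.countP_endpoints ha, card_endpoints, hG.card_edges] at h1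
  have hs' : (0 : ℝ) < 2 * s := by positivity
  have h2 : avoid a s = G.endpoints.countP (fun v => ¬ ∃ i, a i = v) / (2 * s) := by
    have h3 : (2 * s : ℝ) = chainDegSum a s + G.endpoints.countP (fun v => ¬ ∃ i, a i = v) := by
      exact_mod_cast h1
    rw [avoid, eq_div_iff hs'.ne', sub_mul, div_mul_cancel₀ _ hs'.ne']
    linarith
  refine ⟨?_, h2 ▸ by positivity⟩
  rw [attach_toOuterMeasure G (fun v => ¬ ∃ i, a i = v), hG.card_edges, h2]

/-- Disjoint chains occupy disjoint sets of endpoints, so the probabilities of hitting them add up.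
-/
theorem PendantChain.attach_avoid_pair {a b : Fin l → ℕ} (ha : StrictMono a) (hb : StrictMono b)
    (hab : ∀ i j, a i ≠ b j) {s : ℕ} (hs : 1 ≤ s)
    {G : Multigraph} (hG : Valid s G) (h : PendantChain a s G) (h' : PendantChain b s G) :
    G.attach.toOuterMeasure {u | (¬ ∃ i, a i = u) ∧ ¬ ∃ i, b i = u} =
      ENNReal.ofReal (avoid a s + avoid b s - 1) ∧ 0 ≤ avoid a s + avoid b s - 1 := by
  have h1 := Multiset.countP_add_countP_add_countP (fun v => ∃ i, a i = v) (fun v => ∃ i, b i = v)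
    (by rintro v ⟨i, hi⟩ ⟨j, hj⟩; exact hab i j (hi.trans hj.symm)) G.endpoints
  rw [h.countP_endpoints ha, h'.countP_endpoints hb, card_endpoints, hG.card_edges] at h1
  have hs' : (0 : ℝ) < 2 * s := by positivity
  have h2 : avoid a s + avoid b s - 1 =
      G.endpoints.countP (fun v => (¬ ∃ i, a i = v) ∧ ¬ ∃ i, b i = v) / (2 * s) := by
    have h3 : (chainDegSum a s + chainDegSum b s +
      G.endpoints.countP (fun v => (¬ ∃ i, a i = v) ∧ ¬ ∃ i, b i = v) : ℝ) = 2 * s := by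
      exact_mod_cast h1
    have h4 : avoid a s + avoid b s - 1 =
      1 - (chainDegSum a s + chainDegSum b s) / (2 * s) := by simp only [avoid]; ring
    rw [h4, eq_div_iff hs'.ne', sub_mul, div_mul_cancel₀ _ hs'.ne']
    linarith
  refine ⟨?_, h2 ▸ by positivity⟩
  rw [attach_toOuterMeasure G (fun v => (¬ ∃ i, a i = v) ∧ ¬ ∃ i, b i = v), hG.card_edges, h2]

/-- The probability that the pendant chain `a` persists from time `s` to time `s + 1`, if a
vertex-step has probability `p`. -/
noncomputable def persist (p : ℝ) (a : Fin l → ℕ) (s : ℕ) : ℝ :=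
  if ∃ i, a i = s + 1 then
    if ∃ i : Fin l, a i = s + 1 ∧ (i : ℕ) = 0 then p * avoid a s else p / (2 * s)
  else p * avoid a s + (1 - p) * avoid a s ^ 2

/-- The predecessor of the vertex being born is the current tip of the chain, which has only its own
birth edge. -/
theorem chainDeg_eq_one {a : Fin l → ℕ} (ha : StrictMono a) {s : ℕ} {i k : Fin l}
    (hi : a i = s + 1) (hk : (k : ℕ) + 1 = i) : chainDeg a s k = 1 := by
  have h1 : a k ≤ s := by
    have : a k < a i := ha (by rw [Fin.lt_def]; omega)
    omega
  have h2 : ¬ ∃ j : Fin l, (k : ℕ) + 1 = j ∧ a j ≤ s := by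
    rintro ⟨j, hj, h⟩
    have : j = i := Fin.ext (hj.symm.trans hk)
    subst this; omega
  rw [chainDeg, if_pos h1, if_neg h2]

theorem PendantChain.attach_eq {a : Fin l → ℕ} {s : ℕ} {G : Multigraph}
    (hG : Valid s G) (h : PendantChain a s G) {k : Fin l} (hk : chainDeg a s k = 1) :
    G.attach.toOuterMeasure {u | (u : ℕ) = a k} = ENNReal.ofReal (1 / (2 * s)) := by
  rw [attach_toOuterMeasure G (fun v => v = a k), hG.card_edges]
  have : G.endpoints.countP (fun v => v = a k) = 1 := by
    rw [← hk, ← h.degree_eq k, degree, Multiset.count]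
    simp only [eq_comm]
  rw [this, Nat.cast_one]

theorem ofReal_convex (p : unitInterval) {y z : ℝ} (hy : 0 ≤ y) (hz : 0 ≤ z) :
    ENNReal.ofReal p * ENNReal.ofReal y + ENNReal.ofReal (1 - p) * ENNReal.ofReal z =
      ENNReal.ofReal (p * y + (1 - p) * z) := by
  have h0 : (0 : ℝ) ≤ p := p.2.1
  have h1 : (0 : ℝ) ≤ 1 - p := sub_nonneg.2 p.2.2
  rw [← ENNReal.ofReal_mul h0, ← ENNReal.ofReal_mul h1, ← ENNReal.ofReal_add (by positivity)
    (by positivity)]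

theorem PendantChain.persist_le {a : Fin l → ℕ} (ha : StrictMono a) {s : ℕ} (hs : 1 ≤ s)
    {G : Multigraph} (hG : Valid s G) (h : PendantChain a s G) (p : unitInterval) :
    ENNReal.ofReal (persist p a s) ≤
      (G.step p (s + 1)).toOuterMeasure {G' | PendantChain a (s + 1) G'} := by
  have hle : ∀ u : G.verts, (u : ℕ) ≤ s := fun u => (hG.mem_Icc u u.2).2
  obtain ⟨hav, hav0⟩ := h.attach_avoid ha hs hG
  have hp0 : (0 : ℝ) ≤ p := p.2.1
  rw [step_toOuterMeasure]
  simp only [Set.mem_ofPred_eq, pendantChain_addVertex_iff ha hG, h, true_and]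
  unfold persist
  split_ifs with h1 h2
  · obtain ⟨i, hi, hi0⟩ := h2
    rw [ENNReal.ofReal_mul hp0, ← hav]
    refine le_add_right (mul_le_mul_right (MeasureTheory.measure_mono fun u hu => ?_) _)
    exact (extends_addVertex_iff_of_eq ha (hle u) hi).2 (Or.inl ⟨hi0, hu⟩)
  · obtain ⟨i, hi⟩ := h1
    have hi0 : (i : ℕ) ≠ 0 := fun h0 => h2 ⟨i, hi, h0⟩
    let k : Fin l := ⟨i - 1, by omega⟩
    have hk : (k : ℕ) + 1 = i := by simp only [k]; omega
    rw [div_eq_mul_one_div, ENNReal.ofReal_mul hp0, ← h.attach_eq hG (chainDeg_eq_one ha hi hk)]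
    refine le_add_right (mul_le_mul_right (MeasureTheory.measure_mono fun u hu => ?_) _)
    exact (extends_addVertex_iff_of_eq ha (hle u) hi).2 (Or.inr ⟨k, hk, hu⟩)
  · have h1' : ∀ i, a i ≠ s + 1 := fun i hi => h1 ⟨i, hi⟩
    rw [← ofReal_convex p hav0 (by positivity), pow_two, ENNReal.ofReal_mul hav0, ← hav]
    refine add_le_add ?_ ?_
    · refine mul_le_mul_right (MeasureTheory.measure_mono fun u hu => ?_) _
      exact (extends_addVertex_iff_of_ne h1').2 hu
    · refine mul_le_mul_right (le_tsum_attach G (fun u => ¬ ∃ i, a i = u)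
        {G' | PendantChain a (s + 1) G'} fun u v hu hv => ?_) _
      exact (pendantChain_addEdge_iff ha hG u v).2
        ⟨h, (extends_addEdge_iff (hle u) (hle v)).2 ⟨h1', hu, hv⟩⟩

/-- At a birth time of the chain an edge-step destroys the event, and a vertex-step preserves it
only by attaching outside the chain (first vertex) or to the tip (later vertices). -/
theorem PendantChain.le_persist {a : Fin l → ℕ} (ha : StrictMono a) {s : ℕ} (hs : 1 ≤ s)
    {G : Multigraph} (hG : Valid s G) (h : PendantChain a s G) (p : unitInterval)
    (h1 : ∃ i, a i = s + 1) :
    (G.step p (s + 1)).toOuterMeasure {G' | PendantChain a (s + 1) G'} ≤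
      ENNReal.ofReal (persist p a s) := by
  have hle : ∀ u : G.verts, (u : ℕ) ≤ s := fun u => (hG.mem_Icc u u.2).2
  obtain ⟨hav, hav0⟩ := h.attach_avoid ha hs hG
  have hp0 : (0 : ℝ) ≤ p := p.2.1
  obtain ⟨i, hi⟩ := h1
  have hedge : ∀ u v : G.verts, ¬ PendantChain a (s + 1) (G.addEdge u v) := fun u v hC =>
    ((extends_addEdge_iff (hle u) (hle v)).1 ((pendantChain_addEdge_iff ha hG u v).1 hC).2).1 i hi
  rw [step_toOuterMeasure]
  simp only [Set.mem_ofPred_eq, pendantChain_addVertex_iff ha hG, h, true_and, hedge,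
    Set.ofPred_false, MeasureTheory.measure_empty, mul_zero, tsum_zero, add_zero,
    extends_addVertex_iff_of_eq ha (hle _) hi]
  unfold persist
  rw [if_pos ⟨i, hi⟩]
  split_ifs with h2
  · obtain ⟨j, hj, hj0⟩ := h2
    have hi0 : (i : ℕ) = 0 := by rw [← hj0, ha.injective (hi.trans hj.symm)]
    rw [ENNReal.ofReal_mul hp0, ← hav]
    refine mul_le_mul_right (MeasureTheory.measure_mono fun u hu => ?_) _
    rcases hu with hu | ⟨k, hk, -⟩
    · exact hu.2
    · omega
  · have hi0 : (i : ℕ) ≠ 0 := fun h0 => h2 ⟨i, hi, h0⟩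
    let k : Fin l := ⟨i - 1, by omega⟩
    have hk : (k : ℕ) + 1 = i := by simp only [k]; omega
    rw [div_eq_mul_one_div, ENNReal.ofReal_mul hp0, ← h.attach_eq hG (chainDeg_eq_one ha hi hk)]
    refine mul_le_mul_right (MeasureTheory.measure_mono fun u hu => ?_) _
    rcases hu with hu | ⟨k', hk', hu⟩
    · exact absurd hu.1 hi0
    · have : k' = k := Fin.ext (by omega)
      exact this ▸ hu

/-- When neither chain gains a vertex, both have to be avoided, and avoiding disjoint sets is
negatively correlated. -/
theorem PendantChain.le_persist_mul_persist {a b : Fin l → ℕ} (ha : StrictMono a)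
    (hb : StrictMono b) (hab : ∀ i j, a i ≠ b j) {s : ℕ} (hs : 1 ≤ s)
    {G : Multigraph} (hG : Valid s G) (h : PendantChain a s G) (h' : PendantChain b s G)
    (p : unitInterval) (h1 : ¬ ∃ i, a i = s + 1) (h2 : ¬ ∃ i, b i = s + 1) :
    (G.step p (s + 1)).toOuterMeasure
        {G' | PendantChain a (s + 1) G' ∧ PendantChain b (s + 1) G'} ≤
      ENNReal.ofReal (persist p a s * persist p b s) := by
  have hle : ∀ u : G.verts, (u : ℕ) ≤ s := fun u => (hG.mem_Icc u u.2).2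
  obtain ⟨hav, hav0⟩ := h.attach_avoid_pair ha hb hab hs hG h'
  have hp0 : (0 : ℝ) ≤ p := p.2.1
  have hp1 : (p : ℝ) ≤ 1 := p.2.2
  have h1' : ∀ i, a i ≠ s + 1 := fun i hi => h1 ⟨i, hi⟩
  have h2' : ∀ i, b i ≠ s + 1 := fun i hi => h2 ⟨i, hi⟩
  -- With `α = 1 - y` and `β = 1 - z` this is `1 - α - β ≤ (1 - α) * (1 - β)`, used once as it
  -- stands and once with `α`, `β` scaled by `1 - p`; the two inequalities are then multiplied.
  have key : p * (avoid a s + avoid b s - 1) + (1 - p) * (avoid a s + avoid b s - 1) ^ 2 ≤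
      persist p a s * persist p b s := by
    rw [persist, if_neg h1, persist, if_neg h2]
    have ha1 : avoid a s ≤ 1 := by
      rw [avoid, sub_le_self_iff]; positivity
    have hb1 : avoid b s ≤ 1 := by
      rw [avoid, sub_le_self_iff]; positivity
    generalize avoid a s = y at *
    generalize avoid b s = z at *
    generalize (p : ℝ) = p at *
    have hx : 0 ≤ (1 - y) * (1 - z) := mul_nonneg (by linarith) (by linarith)
    have e1 : y + z - 1 ≤ y * z := by linarith
    have hc : 0 ≤ 1 - p := by linarith
    have e2 : p + (1 - p) * (y + z - 1) ≤ (p + (1 - p) * y) * (p + (1 - p) * z) := by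
      nlinarith [mul_nonneg (mul_nonneg hc hc) hx]
    have e3 : 0 ≤ p + (1 - p) * (y + z - 1) := by positivity
    calc p * (y + z - 1) + (1 - p) * (y + z - 1) ^ 2
        = (y + z - 1) * (p + (1 - p) * (y + z - 1)) := by ring
      _ ≤ (y * z) * ((p + (1 - p) * y) * (p + (1 - p) * z)) :=
        mul_le_mul e1 e2 e3 (by linarith)
      _ = _ := by ring
  refine le_trans ?_ (ENNReal.ofReal_le_ofReal key)
  rw [step_toOuterMeasure]
  simp only [Set.mem_ofPred_eq, pendantChain_addVertex_iff ha hG, pendantChain_addVertex_iff hb hG,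
    h, h', true_and]
  rw [← ofReal_convex p hav0 (by positivity), pow_two, ENNReal.ofReal_mul hav0, ← hav]
  refine add_le_add ?_ ?_
  · refine mul_le_mul_right (MeasureTheory.measure_mono fun u hu => ?_) _
    exact ⟨(extends_addVertex_iff_of_ne h1').1 hu.1, (extends_addVertex_iff_of_ne h2').1 hu.2⟩
  · refine mul_le_mul_right (tsum_attach_le G
      (fun u => (¬ ∃ i, a i = u) ∧ ¬ ∃ i, b i = u)
      {G' | PendantChain a (s + 1) G' ∧ PendantChain b (s + 1) G'} fun u v hC => ?_) _
    have e1 := (extends_addEdge_iff (hle u) (hle v)).1 ((pendantChain_addEdge_iff ha hG u v).1 hC.1).2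
    have e2 := (extends_addEdge_iff (hle u) (hle v)).1 ((pendantChain_addEdge_iff hb hG u v).1 hC.2).2
    exact ⟨⟨e1.2.1, e2.2.1⟩, e1.2.2, e2.2.2⟩

/-! ### Starting point, rigidity and length of pendant chains. -/

theorem pendantChain_of_lt {a : Fin l → ℕ} {s : ℕ} {G : Multigraph} (hG : Valid s G)
    (h : ∀ i, s < a i) : PendantChain a s G := by
  have hnot : ∀ i, a i ∉ G.verts := fun i hi => (hG.mem_Icc _ hi).2.not_gt (h i)
  refine ⟨fun i hi => absurd hi (h i).not_ge,
    fun e he i hi => absurd (G.mem_verts e he _ hi) (hnot i), fun i => ?_⟩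
  have h2 : ¬ ∃ j : Fin l, (i : ℕ) + 1 = j ∧ a j ≤ s := fun ⟨j, _, hj⟩ => (h j).not_ge hj
  rw [chainDeg, if_neg (h i).not_ge, if_neg h2, degree, Multiset.count_eq_zero]
  exact fun hi => hnot i (mem_verts_of_mem_endpoints hi)

theorem PendantChain.exists_edge {a : Fin l → ℕ} (ha : StrictMono a) {s : ℕ} {G : Multigraph}
    (h : PendantChain a s G) {i : Fin l} (hi : a i ≤ s) :
    ∃ e ∈ G.edges, e.sup = a i ∧
      (((i : ℕ) = 0 ∧ ∀ k, e.inf ≠ a k) ∨ ∃ k : Fin l, (k : ℕ) + 1 = i ∧ e.inf = a k) := by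
  have h2 : 0 < G.edges.countP (fun e => e.sup = a i) := by
    rw [h.count_sup i hi]; exact one_pos
  obtain ⟨e, he, h3⟩ := Multiset.countP_pos.1 h2
  obtain ⟨j, hj, h4⟩ := h.fits e he i (h3 ▸ sup_mem e)
  have : j = i := ha.injective (hj.symm.trans h3)
  exact ⟨e, he, h3, this ▸ h4⟩

theorem inf_mem (e : Sym2 ℕ) : e.inf ∈ e := by
  induction e with
  | _ x y => rcases le_total x y with h | h <;> simp [h]

/-- Two pendant chains of the same length that meet in vertices of the same rank are equal. -/
theorem PendantChain.eq_of_meet {a b : Fin l → ℕ} (ha : StrictMono a) {s : ℕ}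
    {G : Multigraph} (h : PendantChain a s G) (h' : PendantChain b s G)
    (has : ∀ i, a i ≤ s) (hab : ∀ i j, a i = b j → i = j) {i₀ : Fin l} (h₀ : a i₀ = b i₀) :
    a = b := by
  -- The birth edge of `a j` joins `a i` to `a j`. If it touches `b`, then `fits` makes its larger
  -- endpoint a vertex of `b`, of rank `j` by `hab`; so equality passes between neighbouring ranks
  -- in both directions.
  have key : ∀ i j : Fin l, (i : ℕ) + 1 = j → (a i = b i ↔ a j = b j) := by
    intro i j hij
    obtain ⟨e, he, hsup, h0 | ⟨k, hk, hinf⟩⟩ := h.exists_edge ha (has j)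
    · omega
    have hki : k = i := Fin.ext (by omega)
    subst hki
    constructor
    · intro hi
      obtain ⟨j', hj', -⟩ := h'.fits e he k (by rw [← hi, ← hinf]; exact inf_mem e)
      have := hab j j' (hsup.symm.trans hj')
      rw [← hsup, hj', this]
    · intro hj
      obtain ⟨j', hj', h4⟩ := h'.fits e he j (by rw [← hj, ← hsup]; exact sup_mem e)
      have := hab j j' (hsup.symm.trans hj')
      subst this
      rcases h4 with h4 | ⟨k', hk', h4⟩
      · omega
      · have : k' = k := Fin.ext (by omega)
        rw [← hinf, h4, this]
  have up : ∀ n (i : Fin l), (i : ℕ) = n → (a i = b i ↔ a i₀ = b i₀) := by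
    have base : ∀ n (i j : Fin l), (i : ℕ) + n = j → (a i = b i ↔ a j = b j) := by
      intro n
      induction n with
      | zero => intro i j hij; rw [show i = j from Fin.ext hij]
      | succ n ih =>
        intro i j hij
        have hj := j.2
        exact (key i ⟨i + 1, by omega⟩ rfl).trans (ih _ j (by simp only; omega))
    intro n i _
    rcases le_total (i : ℕ) i₀ with hle | hle
    · exact base (i₀ - i) i i₀ (by omega)
    · exact (base (i - i₀) i₀ i (by omega)).symm
  exact funext fun i => (up i i rfl).2 h₀

/-- The only way out of the chain is through its first vertex. The function that is rank plus one on
the chain and `0` off it changes by at most one along an edge, so it bounds the distance from the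
last vertex of the chain to vertex `1`. -/
theorem PendantChain.le_diam {a : Fin l → ℕ} (ha : StrictMono a) {s : ℕ} {G : Multigraph}
    (hG : Valid s G) (h : PendantChain a s G) (has : ∀ i, a i ≤ s) (ha1 : ∀ i, a i ≠ 1) :
    l ≤ G.diam := by
  classical
  rcases Nat.eq_zero_or_pos l with h0 | hl
  · omega
  let φ : ℕ → ℕ := fun v => ∑ i, if a i = v then (i : ℕ) + 1 else 0
  have hφ : ∀ i, φ (a i) = i + 1 := fun i => by
    simp only [φ]
    rw [Finset.sum_eq_single i]
    · simp
    · intro j _ hj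
      rw [if_neg fun h => hj (ha.injective h)]
    · simp
  have hφ0 : ∀ v, (∀ i, a i ≠ v) → φ v = 0 := fun v hv => by
    simp [φ, hv]
  have hstep : ∀ u v : G.verts, G.toSimpleGraph.Adj u v → φ u ≤ φ v + 1 := by
    intro u v ⟨huv, he⟩
    have huv' : (u : ℕ) ≠ v := fun h => huv (Subtype.ext h)
    by_cases hu : ∃ i, a i = u
    · obtain ⟨i, hi⟩ := hu
      obtain ⟨j, hj, h4⟩ := h.fits _ he i (by simp [hi])
      simp only [Sym2.sup_mk, Sym2.inf_mk] at hj h4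
      rw [← hi, hφ]
      rcases lt_or_gt_of_ne huv' with hlt | hlt
      · rw [sup_eq_right.2 hlt.le] at hj
        rw [inf_eq_left.2 hlt.le] at h4
        rcases h4 with h4 | ⟨k, hk, h4⟩
        · exact absurd hi.symm (h4.2 i)
        · have : k = i := ha.injective (h4.symm.trans hi.symm)
          rw [hj, hφ, ← hk, this]; omega
      · rw [sup_eq_left.2 hlt.le] at hj
        rw [inf_eq_right.2 hlt.le] at h4
        have : j = i := ha.injective (hj.symm.trans hi.symm)
        subst this
        rcases h4 with h4 | ⟨k, hk, h4⟩
        · omega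
        · rw [h4, hφ, hk]
    · rw [hφ0 u fun i hi => hu ⟨i, hi⟩]
      omega
  have hwalk : ∀ (u v : G.verts) (w : G.toSimpleGraph.Walk u v), φ u ≤ φ v + w.length := by
    intro u v w
    induction w with
    | nil => simp
    | cons hadj w ih =>
      have := hstep _ _ hadj
      rw [SimpleGraph.Walk.length_cons]
      omega
  let i : Fin l := ⟨l - 1, by omega⟩
  obtain ⟨e, he, hsup, -⟩ := h.exists_edge ha (has i)
  have hmem : a i ∈ G.verts := G.mem_verts e he _ (hsup ▸ sup_mem e)
  obtain ⟨w, hw⟩ := hG.connected.exists_walk_length_eq_dist ⟨a i, hmem⟩ ⟨1, hG.one_mem⟩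
  have h1 := hwalk _ _ w
  rw [hφ, hφ0 1 ha1, hw] at h1
  have : Nonempty G.verts := ⟨⟨1, hG.one_mem⟩⟩
  have h2 := SimpleGraph.dist_le_diam (SimpleGraph.connected_iff_ediam_ne_top.1 hG.connected)
    (u := ⟨a i, hmem⟩) (v := ⟨1, hG.one_mem⟩)
  have hi : (i : ℕ) + 1 = l := by simp only [i]; omega
  unfold diam
  omega

/-! ### Probabilities of whole chains and of pairs of chains. -/

/-- The probability that the pendant chain `a` is built from time `r` to time `t`. -/
noncomputable def chainProb (f : ℕ → unitInterval) (a : Fin l → ℕ) (r t : ℕ) : ℝ :=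
  ∏ s ∈ Finset.Ico r t, persist (f (s + 1)) a s

theorem le_avoid {r s : ℕ} (hr : 1 ≤ r) (hrs : r ≤ s) (a : Fin l → ℕ) :
    1 - (l : ℝ) / r ≤ avoid a s := by
  have h1 : (chainDegSum a s : ℝ) ≤ 2 * l := by exact_mod_cast chainDegSum_le a s
  have hr' : (0 : ℝ) < r := by positivity
  have hrs' : (r : ℝ) ≤ s := by exact_mod_cast hrs
  have : (chainDegSum a s : ℝ) / (2 * s) ≤ l / r := by
    rw [div_le_div_iff₀ (by linarith) hr']
    have : (0 : ℝ) ≤ l := by positivity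
    nlinarith
  unfold avoid
  linarith

theorem avoid_le_one (a : Fin l → ℕ) (s : ℕ) : avoid a s ≤ 1 := by
  rw [avoid, sub_le_self_iff]; positivity

/-- Even an edge-step only has to avoid the chain twice, and `(1 - l / r) ^ 2 ≥ 1 - 2 * l / r`. -/
theorem le_persist_of_notMem {r s : ℕ} (hr : 1 ≤ r) (hl : l ≤ r) (hrs : r ≤ s) {a : Fin l → ℕ}
    (p : unitInterval) (h : ¬ ∃ i, a i = s + 1) : 1 - 2 * (l : ℝ) / r ≤ persist p a s := by
  have h1 := le_avoid hr hrs a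
  have h2 := avoid_le_one a s
  have hp0 : (0 : ℝ) ≤ p := p.2.1
  have hl' : (l : ℝ) / r ≤ 1 := div_le_one_of_le₀ (by exact_mod_cast hl) (by positivity)
  rw [persist, if_neg h]
  have h3 : 0 ≤ avoid a s := by linarith
  have h4 : avoid a s ^ 2 ≤ avoid a s := by nlinarith
  have h5 : 1 - 2 * (l : ℝ) / r ≤ avoid a s ^ 2 := by
    have : 2 * (l : ℝ) / r = 2 * (l / r) := by ring
    rw [this]
    nlinarith [sq_nonneg ((l : ℝ) / r)]
  nlinarith

theorem persist_nonneg {r s : ℕ} (hr : 1 ≤ r) (hl : l ≤ r) (hrs : r ≤ s) (a : Fin l → ℕ)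
    (p : unitInterval) : 0 ≤ persist p a s := by
  have h1 := le_avoid hr hrs a
  have hp0 : (0 : ℝ) ≤ p := p.2.1
  have hp1 : (p : ℝ) ≤ 1 := p.2.2
  have hl' : (l : ℝ) / r ≤ 1 := div_le_one_of_le₀ (by exact_mod_cast hl) (by positivity)
  have h3 : 0 ≤ avoid a s := by linarith
  have h4 : (0 : ℝ) ≤ 1 - p := by linarith
  unfold persist
  split_ifs <;> positivity

theorem chainProb_nonneg {r t : ℕ} (hr : 1 ≤ r) (hl : l ≤ r) (a : Fin l → ℕ)
    (f : ℕ → unitInterval) : 0 ≤ chainProb f a r t :=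
  Finset.prod_nonneg fun _ hs => persist_nonneg hr hl (Finset.mem_Ico.1 hs).1 a _

theorem chainProb_succ {r t : ℕ} (hrt : r ≤ t) (a : Fin l → ℕ) (f : ℕ → unitInterval) :
    chainProb f a r (t + 1) = chainProb f a r t * persist (f (t + 1)) a t :=
  Finset.prod_Ico_succ_top hrt _

/-- At time `r` the event is certain because no vertex of the chain is born yet; afterwards each
step contributes its factor `persist`. -/
theorem chainProb_le (f : ℕ → unitInterval) {a : Fin l → ℕ} (ha : StrictMono a) {r t : ℕ}
    (hr : 1 ≤ r) (hl : l ≤ r) (hra : ∀ i, r < a i) (hrt : r ≤ t) :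
    ENNReal.ofReal (chainProb f a r t) ≤
      (edgeStepLaw f t).toOuterMeasure {G | PendantChain a t G} := by
  induction t, hrt using Nat.le_induction with
  | base =>
    rw [(PMF.toOuterMeasure_apply_eq_one_iff _ {G | PendantChain a r G}).2 fun G hG =>
      pendantChain_of_lt (valid_of_mem_support f hr G hG) hra]
    simp [chainProb]
  | succ t hrt ih =>
    rw [chainProb_succ hrt, ENNReal.ofReal_mul (chainProb_nonneg hr hl a f),
      edgeStepLaw_succ f (hr.trans hrt)]
    refine le_trans (mul_le_mul_left ih _) (PMF.mul_le_toOuterMeasure_bind _ _ _ _ _ ?_)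
    exact fun G hG h =>
      h.persist_le ha (hr.trans hrt) (valid_of_mem_support f (hr.trans hrt) G hG) _

theorem PendantChain.of_step {a : Fin l → ℕ} (ha : StrictMono a) {s : ℕ} {G G' : Multigraph}
    (hG : Valid s G) {p : unitInterval} (hG' : G' ∈ (G.step p (s + 1)).support)
    (h : PendantChain a (s + 1) G') : PendantChain a s G := by
  rcases mem_support_step hG' with ⟨u, rfl⟩ | ⟨u, v, rfl⟩
  · exact ((pendantChain_addVertex_iff ha hG u).1 h).1
  · exact ((pendantChain_addEdge_iff ha hG u v).1 h).1

/-- At a birth in one chain, the joint probability is bounded by that chain's factor alone. The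
missing factor of the other chain, which only has to be avoided, is at least `1 - 2 * l / r`. -/
theorem pair_step {a b : Fin l → ℕ} (ha : StrictMono a) (hb : StrictMono b)
    (hab : ∀ i j, a i ≠ b j) {r s : ℕ} (hr : 1 ≤ r) (hl : 2 * l ≤ r) (hrs : r ≤ s)
    {G : Multigraph} (hG : Valid s G) (h : PendantChain a s G) (h' : PendantChain b s G)
    (p : unitInterval) :
    (G.step p (s + 1)).toOuterMeasure
        {G' | PendantChain a (s + 1) G' ∧ PendantChain b (s + 1) G'} *
      ENNReal.ofReal (if (∃ i, a i = s + 1) ∨ ∃ i, b i = s + 1 then 1 - 2 * (l : ℝ) / r else 1) ≤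
      ENNReal.ofReal (persist p a s * persist p b s) := by
  have hs := hr.trans hrs
  have hl' : l ≤ r := by omega
  by_cases h1 : ∃ i, a i = s + 1
  · have h2 : ¬ ∃ i, b i = s + 1 := fun ⟨j, hj⟩ => by
      obtain ⟨i, hi⟩ := h1
      exact hab i j (hi.trans hj.symm)
    rw [if_pos (Or.inl h1), ENNReal.ofReal_mul (persist_nonneg hr hl' hrs a p)]
    gcongr
    · exact (MeasureTheory.measure_mono fun G' hG' => hG'.1).trans (h.le_persist ha hs hG p h1)
    · exact le_persist_of_notMem hr hl' hrs p h2
  · by_cases h2 : ∃ i, b i = s + 1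
    · rw [if_pos (Or.inr h2), mul_comm (persist p a s),
        ENNReal.ofReal_mul (persist_nonneg hr hl' hrs b p)]
      gcongr
      · exact (MeasureTheory.measure_mono fun G' hG' => hG'.2).trans (h'.le_persist hb hs hG p h2)
      · exact le_persist_of_notMem hr hl' hrs p h1
    · rw [if_neg (by simp only [h1, h2, or_self, not_false_eq_true]), ENNReal.ofReal_one, mul_one]
      exact h.le_persist_mul_persist ha hb hab hs hG h' p h1 h2

end Multigraph

theorem PMF.toOuterMeasure_le_one {α : Type*} (p : PMF α) (S : Set α) :
    p.toOuterMeasure S ≤ 1 :=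
  (MeasureTheory.measure_mono (Set.subset_univ S)).trans_eq
    ((PMF.toOuterMeasure_apply_eq_one_iff p _).2 (Set.subset_univ _))

namespace Multigraph

variable {l : ℕ}

theorem pair_le_prod (f : ℕ → unitInterval) {a b : Fin l → ℕ} (ha : StrictMono a)
    (hb : StrictMono b) (hab : ∀ i j, a i ≠ b j) {r t : ℕ} (hr : 1 ≤ r) (hl : 2 * l ≤ r)
    (hrt : r ≤ t) :
    (edgeStepLaw f t).toOuterMeasure {G | PendantChain a t G ∧ PendantChain b t G} *
      ENNReal.ofReal (∏ s ∈ Finset.Ico r t,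
        if (∃ i, a i = s + 1) ∨ ∃ i, b i = s + 1 then 1 - 2 * (l : ℝ) / r else 1) ≤
      ENNReal.ofReal (chainProb f a r t * chainProb f b r t) := by
  have hl' : l ≤ r := by omega
  have hε : 0 ≤ 1 - 2 * (l : ℝ) / r := by
    have : 2 * (l : ℝ) / r ≤ 1 := div_le_one_of_le₀ (by exact_mod_cast hl) (by positivity)
    linarith
  induction t, hrt using Nat.le_induction with
  | base => simpa [chainProb] using PMF.toOuterMeasure_le_one _ _
  | succ t hrt ih =>
    rw [chainProb_succ hrt, chainProb_succ hrt, Finset.prod_Ico_succ_top hrt, mul_mul_mul_comm,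
      ENNReal.ofReal_mul (mul_nonneg (chainProb_nonneg hr hl' a f) (chainProb_nonneg hr hl' b f)),
      ENNReal.ofReal_mul (Finset.prod_nonneg fun _ _ => by split_ifs <;> positivity),
      edgeStepLaw_succ f (hr.trans hrt)]
    set κ := ∏ s ∈ Finset.Ico r t,
        if (∃ i, a i = s + 1) ∨ ∃ i, b i = s + 1 then 1 - 2 * (l : ℝ) / r else 1
    set c := ENNReal.ofReal
      (if (∃ i, a i = t + 1) ∨ ∃ i, b i = t + 1 then 1 - 2 * (l : ℝ) / r else 1)
    refine le_trans ?_ (mul_le_mul_left ih _)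
    rw [mul_right_comm, mul_comm (ENNReal.ofReal κ), ← mul_assoc]
    refine mul_le_mul_left ?_ _
    rw [PMF.toOuterMeasure_bind_apply, PMF.toOuterMeasure_apply, ← ENNReal.tsum_mul_right,
      ← ENNReal.tsum_mul_right]
    refine ENNReal.tsum_le_tsum fun G => ?_
    by_cases hp : G ∈ (edgeStepLaw f t).support
    · have hG := valid_of_mem_support f (hr.trans hrt) G hp
      by_cases hC : PendantChain a t G ∧ PendantChain b t G
      · rw [Set.indicator_of_mem (by exact hC), mul_assoc]
        exact mul_le_mul_right (pair_step ha hb hab hr hl hrt hG hC.1 hC.2 _) _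
      · have : ((G.step (f (t + 1)) (t + 1)).toOuterMeasure
            {G' | PendantChain a (t + 1) G' ∧ PendantChain b (t + 1) G'}) = 0 := by
          rw [PMF.toOuterMeasure_apply_eq_zero_iff, Set.disjoint_left]
          exact fun G' hG' hT => hC ⟨hT.1.of_step ha hG hG', hT.2.of_step hb hG hG'⟩
        simp [this]
    · have : edgeStepLaw f t G = 0 := ((edgeStepLaw f t).apply_eq_zero_iff G).2 hp
      simp [this]

/-- The correction factor occurs once per birth, hence at most `2 * l` times, and Bernoulli's
inequality bounds its power. -/
theorem pair_le (f : ℕ → unitInterval) {a b : Fin l → ℕ} (ha : StrictMono a)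
    (hb : StrictMono b) (hab : ∀ i j, a i ≠ b j) {r t : ℕ} (hr : 1 ≤ r) (hl : 2 * l ≤ r)
    (hrt : r ≤ t) :
    (edgeStepLaw f t).toOuterMeasure {G | PendantChain a t G ∧ PendantChain b t G} *
      ENNReal.ofReal (1 - 4 * (l : ℝ) ^ 2 / r) ≤
      ENNReal.ofReal (chainProb f a r t) * ENNReal.ofReal (chainProb f b r t) := by
  have hl' : l ≤ r := by omega
  rw [← ENNReal.ofReal_mul (chainProb_nonneg hr hl' a f)]
  refine le_trans (mul_le_mul_right (ENNReal.ofReal_le_ofReal ?_) _)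
    (pair_le_prod f ha hb hab hr hl hrt)
  have hε' : 2 * (l : ℝ) / r ≤ 1 := div_le_one_of_le₀ (by exact_mod_cast hl) (by positivity)
  have hε : 0 ≤ 1 - 2 * (l : ℝ) / r := by linarith
  rw [Finset.prod_ite, Finset.prod_const, Finset.prod_const_one, mul_one]
  have hcard : (Finset.filter (fun s => (∃ i, a i = s + 1) ∨ ∃ i, b i = s + 1)
      (Finset.Ico r t)).card ≤ 2 * l := by
    have hsub : (Finset.filter (fun s => (∃ i, a i = s + 1) ∨ ∃ i, b i = s + 1)
        (Finset.Ico r t)) ⊆ Finset.univ.image (fun i => a i - 1) ∪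
          Finset.univ.image (fun i => b i - 1) := by
      intro s hs
      simp only [Finset.mem_union, Finset.mem_image, Finset.mem_univ, true_and]
      rcases (Finset.mem_filter.1 hs).2 with ⟨i, hi⟩ | ⟨i, hi⟩
      · exact Or.inl ⟨i, by omega⟩
      · exact Or.inr ⟨i, by omega⟩
    refine (Finset.card_le_card hsub).trans ((Finset.card_union_le _ _).trans ?_)
    have h1 := Finset.card_image_le (s := Finset.univ) (f := fun i => a i - 1)
    have h2 := Finset.card_image_le (s := Finset.univ) (f := fun i => b i - 1)
    simp only [Finset.card_univ, Fintype.card_fin] at h1 h2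
    omega
  calc 1 - 4 * (l : ℝ) ^ 2 / r = 1 + ((2 * l : ℕ) : ℝ) * (-(2 * (l : ℝ) / r)) := by
        push_cast; ring
    _ ≤ (1 + (-(2 * (l : ℝ) / r))) ^ (2 * l) := one_add_mul_le_pow (by linarith) _
    _ = (1 - 2 * (l : ℝ) / r) ^ (2 * l) := by ring
    _ ≤ _ := pow_le_pow_of_le_one hε (sub_le_self _ (by positivity)) hcard

/-- Every step is charged the avoidance factor, including births. Each birth also costs `p`, and
each birth but the first costs `1 / (2 * t)`; the missing one accounts for the prefactor `2 * t`. -/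
theorem le_chainProb (f : ℕ → unitInterval) {a : Fin l → ℕ} (ha : StrictMono a) {r t : ℕ}
    (hr : 1 ≤ r) (hl : 2 * l ≤ r) (hl1 : 1 ≤ l) (hra : ∀ i, r < a i) (hat : ∀ i, a i ≤ t)
    {p : ℝ} (hp0 : 0 ≤ p) (hp : ∀ s, 1 ≤ s → s ≤ t → p ≤ f s) :
    (1 - 2 * (l : ℝ) / r) ^ (t - r) * (2 * t * (p / (2 * t)) ^ l) ≤ chainProb f a r t := by
  have hl' : l ≤ r := by omega
  have hε' : 2 * (l : ℝ) / r ≤ 1 := div_le_one_of_le₀ (by exact_mod_cast hl) (by positivity)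
  have hε : 0 ≤ 1 - 2 * (l : ℝ) / r := by linarith
  have hrt : r < t := (hra ⟨0, hl1⟩).trans_le (hat _)
  have htpos : (0 : ℝ) < 2 * t := by
    have : (0 : ℝ) < t := by exact_mod_cast (by omega : 0 < t)
    positivity
  let c : Fin l → ℝ := fun i => p * if (i : ℕ) = 0 then (1 : ℝ) else 1 / (2 * (t : ℝ))
  have hc : ∏ i, c i = 2 * t * (p / (2 * t)) ^ l := by
    obtain ⟨k, rfl⟩ := Nat.exists_eq_add_of_le' hl1
    rw [Fin.prod_univ_succ]
    simp only [c, Fin.val_zero, if_true, mul_one, Fin.val_succ, Nat.succ_ne_zero, if_false,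
      Finset.prod_const, Finset.card_univ, Fintype.card_fin, ← div_eq_mul_one_div]
    have ht0 : (t : ℝ) ≠ 0 := fun h => by simp [h] at htpos
    rw [pow_succ]
    field_simp
  -- The cost `c i` is charged to the step `s = a i - 1` that creates `a i`, so that the two
  -- products can be compared factor by factor.
  have hw : ∏ s ∈ Finset.Ico r t, ∏ i, (if a i = s + 1 then c i else 1) = ∏ i, c i := by
    rw [Finset.prod_comm]
    refine Finset.prod_congr rfl fun i _ => ?_
    have h1 := hra i
    have h2 := hat i
    rw [Finset.prod_eq_single (a i - 1)]
    · rw [if_pos (by omega)]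
    · intro s _ hs
      rw [if_neg (by omega)]
    · intro h
      exact absurd (Finset.mem_Ico.2 (by omega)) h
  rw [← hc, ← hw, ← Nat.card_Ico, ← Finset.prod_const, ← Finset.prod_mul_distrib]
  have hc0 : ∀ i, 0 ≤ c i := fun i => by simp only [c]; split_ifs <;> positivity
  refine Finset.prod_le_prod (fun s _ => mul_nonneg hε (Finset.prod_nonneg fun i _ => ?_))
    fun s hs => ?_
  · split_ifs
    · exact hc0 i
    · exact zero_le_one
  · obtain ⟨hs1, hs2⟩ := Finset.mem_Ico.1 hs
    by_cases h : ∃ i, a i = s + 1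
    · obtain ⟨i, hi⟩ := h
      have hpf : p ≤ f (s + 1) := hp _ (by omega) (by omega)
      rw [Finset.prod_eq_single i (fun j _ hj => if_neg fun h => hj (ha.injective (h.trans hi.symm)))
        (fun h => absurd (Finset.mem_univ i) h), if_pos hi, persist, if_pos ⟨i, hi⟩]
      split_ifs with h2
      · obtain ⟨j, hj, hj0⟩ := h2
        have hi0 : (i : ℕ) = 0 := by rw [← hj0, ha.injective (hi.trans hj.symm)]
        have hav := le_avoid hr hs1 a
        have hlr : (l : ℝ) / r ≤ 2 * l / r := by
          gcongr; linarith [show (0 : ℝ) ≤ l by positivity]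
        simp only [c, hi0, if_true, mul_one]
        rw [mul_comm]
        exact mul_le_mul hpf (by linarith) hε (hp0.trans hpf)
      · have hi0 : (i : ℕ) ≠ 0 := fun h0 => h2 ⟨i, hi, h0⟩
        have hs0 : (0 : ℝ) < s := by exact_mod_cast (by omega : 0 < s)
        have hst : (s : ℝ) ≤ t := by exact_mod_cast hs2.le
        calc (1 - 2 * (l : ℝ) / r) * c i ≤ 1 * c i := by
              have := hc0 i
              gcongr
              exact sub_le_self _ (by positivity)
          _ = p * (1 / (2 * t)) := by simp [c, hi0]
          _ ≤ f (s + 1) * (1 / (2 * s)) := by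
              gcongr
              exact hp0.trans hpf
          _ = f (s + 1) / (2 * s) := by ring
    · rw [Finset.prod_eq_one fun i _ => if_neg fun hi => h ⟨i, hi⟩, mul_one]
      exact le_persist_of_notMem hr hl' hs1 _ h

end Multigraph

/-! ### The second moment inequality. -/

/-- The second moment method: a counting variable `N` with `E N ^ 2 ≤ E N + (E N) ^ 2 / δ`. -/
theorem PMF.second_moment {α ι : Type*} (p : PMF α) (I : Finset ι) (S : ι → Set α) (T : Set α)
    (hT : ∀ i ∈ I, p.toOuterMeasure (S i \ T) = 0) (δ M : ℝ≥0∞) (hM0 : M ≠ 0)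
    (hM : M ≤ ∑ i ∈ I, p.toOuterMeasure (S i)) (w : ι → ℝ≥0∞) (hδ : δ ≠ 0) (hδt : δ ≠ ∞)
    (hw : ∀ i ∈ I, w i ≤ p.toOuterMeasure (S i))
    (h2 : ∀ i ∈ I, ∀ j ∈ I, i ≠ j → p.toOuterMeasure (S i ∩ S j) * δ ≤ w i * w j) :
    2 ≤ p.toOuterMeasure T + (M⁻¹ + δ⁻¹) := by
  classical
  set m := ∑ i ∈ I, p.toOuterMeasure (S i) with hm
  have hm0 : m ≠ 0 := fun h => hM0 (le_zero_iff.1 (h ▸ hM))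
  have hmt : m ≠ ∞ := ENNReal.sum_ne_top.2 fun i _ =>
    ne_top_of_le_ne_top ENNReal.one_ne_top (PMF.toOuterMeasure_le_one _ _)
  set N : α → ℝ≥0∞ := fun x => ∑ i ∈ I, (S i).indicator 1 x with hN
  have hNt : ∀ x, N x ≠ ∞ := fun x => ENNReal.sum_ne_top.2 fun i _ => by
    by_cases h : x ∈ S i <;> simp [h]
  have hind : ∀ (A : Set α), p.toOuterMeasure A = ∑' x, p x * A.indicator 1 x := fun A => by
    rw [PMF.toOuterMeasure_apply]
    refine tsum_congr fun x => ?_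
    by_cases h : x ∈ A <;> simp [h]
  have hE : ∑' x, p x * N x = m := by
    simp only [hN, hm, Finset.mul_sum]
    rw [Summable.tsum_finsetSum fun _ _ => ENNReal.summable]
    exact Finset.sum_congr rfl fun i _ => (hind _).symm
  have hE2 : ∑' x, p x * (N x * N x) = ∑ i ∈ I, ∑ j ∈ I, p.toOuterMeasure (S i ∩ S j) := by
    simp only [hN, Finset.mul_sum, Finset.sum_mul]
    rw [Summable.tsum_finsetSum fun _ _ => ENNReal.summable, Finset.sum_comm]
    refine Finset.sum_congr rfl fun i _ => ?_
    rw [Summable.tsum_finsetSum fun _ _ => ENNReal.summable]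
    refine Finset.sum_congr rfl fun j _ => ?_
    rw [hind]
    refine tsum_congr fun x => ?_
    by_cases h : x ∈ S i <;> by_cases h' : x ∈ S j <;> simp [h, h']
  have hE2' : ∑' x, p x * (N x * N x) ≤ m + m * m * δ⁻¹ := by
    rw [hE2]
    calc ∑ i ∈ I, ∑ j ∈ I, p.toOuterMeasure (S i ∩ S j)
        ≤ ∑ i ∈ I, ∑ j ∈ I, ((if i = j then p.toOuterMeasure (S i) else 0) +
            p.toOuterMeasure (S i) * p.toOuterMeasure (S j) * δ⁻¹) := by
          refine Finset.sum_le_sum fun i hi => Finset.sum_le_sum fun j hj => ?_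
          by_cases hij : i = j
          · subst hij; simp
          · rw [if_neg hij, zero_add, ← div_eq_mul_inv, ENNReal.le_div_iff_mul_le (Or.inl hδ)
              (Or.inl hδt)]
            exact (h2 i hi j hj hij).trans (mul_le_mul' (hw i hi) (hw j hj))
      _ = m + m * m * δ⁻¹ := by
          simp only [Finset.sum_add_distrib, Finset.sum_ite_eq]
          congr 1
          · exact Finset.sum_congr rfl fun i hi => if_pos hi
          · rw [hm, Finset.sum_mul_sum, Finset.sum_mul]
            exact Finset.sum_congr rfl fun i _ => (Finset.sum_mul _ _ _).symm
  -- With `z = N x / m`, this is `2 * z ≤ 1 + z ^ 2` on `T`, while off `T` the count vanishes almost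
  -- surely by `hT`. Integrating it gives the claim without computing a variance.
  have hpt : ∀ x, p x * (2 * (m⁻¹ * N x)) ≤
      p x * T.indicator 1 x + p x * (N x * N x) * (m⁻¹ * m⁻¹) := by
    intro x
    by_cases hpx : p x = 0
    · simp [hpx]
    rw [mul_assoc, ← mul_add]
    refine mul_le_mul_right ?_ _
    by_cases hx : x ∈ T
    · rw [Set.indicator_of_mem hx]
      have hz : m⁻¹ * N x ≠ ∞ := ENNReal.mul_ne_top (ENNReal.inv_ne_top.2 hm0) (hNt x)
      have : N x * N x * (m⁻¹ * m⁻¹) = (m⁻¹ * N x) * (m⁻¹ * N x) := by ring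
      rw [this]
      lift m⁻¹ * N x to NNReal using hz with z
      simp only [Pi.one_apply]
      norm_cast
      rw [← NNReal.coe_le_coe]
      push_cast
      nlinarith [sq_nonneg ((z : ℝ) - 1)]
    · have hN0 : N x = 0 := Finset.sum_eq_zero fun i hi => by
        refine Set.indicator_of_notMem (fun hxi => ?_) _
        have := (PMF.toOuterMeasure_apply_eq_zero_iff p _).1 (hT i hi)
        exact Set.disjoint_left.1 this ((p.mem_support_iff x).2 hpx) ⟨hxi, hx⟩
      simp [hN0]
  have hmm : m⁻¹ * m = 1 := ENNReal.inv_mul_cancel hm0 hmt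
  calc (2 : ℝ≥0∞) = ∑' x, p x * (2 * (m⁻¹ * N x)) := by
        have : ∀ x, p x * (2 * (m⁻¹ * N x)) = 2 * m⁻¹ * (p x * N x) := fun x => by ring
        simp only [this, ENNReal.tsum_mul_left, hE]
        rw [mul_assoc, hmm, mul_one]
    _ ≤ ∑' x, (p x * T.indicator 1 x + p x * (N x * N x) * (m⁻¹ * m⁻¹)) :=
        ENNReal.tsum_le_tsum hpt
    _ = p.toOuterMeasure T + (∑' x, p x * (N x * N x)) * (m⁻¹ * m⁻¹) := by
        rw [ENNReal.tsum_add, ← hind, ENNReal.tsum_mul_right]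
    _ ≤ p.toOuterMeasure T + (m + m * m * δ⁻¹) * (m⁻¹ * m⁻¹) := by gcongr
    _ = p.toOuterMeasure T + (m⁻¹ * (m⁻¹ * m) + (m⁻¹ * m) * (m⁻¹ * m) * δ⁻¹) := by ring
    _ = p.toOuterMeasure T + (m⁻¹ + δ⁻¹) := by rw [hmm]; simp
    _ ≤ p.toOuterMeasure T + (M⁻¹ + δ⁻¹) := by gcongr

open Multigraph

/-! ### The block family of chains and its second moment. -/

/-- The chains of length `l` with one vertex in each of `l` consecutive blocks of length `m`. -/
def blockChains (l r m : ℕ) : Finset (Fin l → ℕ) :=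
  Fintype.piFinset fun i : Fin l => Finset.Ioc (r + i * m) (r + (i + 1) * m)

theorem card_blockChains (l r m : ℕ) : (blockChains l r m).card = m ^ l := by
  have : ∀ i : Fin l, (r + ((i : ℕ) + 1) * m) - (r + i * m) = m := fun i => by
    rw [add_mul, one_mul]; omega
  simp [blockChains, Fintype.card_piFinset, this]

/-- The blocks are ordered and common to all chains of the family, so a vertex shared by two chains
has the same rank in both, as `PendantChain.eq_of_meet` requires. -/
theorem blockChains_rank {l r m : ℕ} {a b : Fin l → ℕ} (ha : a ∈ blockChains l r m)
    (hb : b ∈ blockChains l r m) {i j : Fin l} (h : a i ≤ b j) : i ≤ j := by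
  have h1 := (Finset.mem_Ioc.1 (Fintype.mem_piFinset.1 ha i)).1
  have h2 := (Finset.mem_Ioc.1 (Fintype.mem_piFinset.1 hb j)).2
  have h3 : (i : ℕ) * m < (j + 1) * m := by omega
  have := Nat.lt_of_mul_lt_mul_right h3
  rw [Fin.le_def]
  omega

theorem blockChains_strictMono {l r m : ℕ} {a : Fin l → ℕ} (ha : a ∈ blockChains l r m) :
    StrictMono a := fun _ _ hij =>
  lt_of_not_ge fun h => (blockChains_rank ha ha h).not_gt hij

theorem lt_of_mem_blockChains {l r m : ℕ} {a : Fin l → ℕ} (ha : a ∈ blockChains l r m)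
    (i : Fin l) : r < a i := by
  have h1 := (Finset.mem_Ioc.1 (Fintype.mem_piFinset.1 ha i)).1
  omega

theorem le_of_mem_blockChains {l r m : ℕ} {a : Fin l → ℕ} (ha : a ∈ blockChains l r m)
    (i : Fin l) : a i ≤ r + l * m := by
  have h2 := (Finset.mem_Ioc.1 (Fintype.mem_piFinset.1 ha i)).2
  have h3 : ((i : ℕ) + 1) * m ≤ l * m := Nat.mul_le_mul_right _ i.2
  omega

/-- The second moment method for the number of chains in the block family: `m ^ l` chains, each with
at least the probability of `le_chainProb`, where antitonicity replaces every `f s` by `f t`. -/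
theorem diam_second_moment (f : ℕ → unitInterval) (hf : AntitoneOn f (Set.Ici 1)) {l r m t : ℕ}
    (hl1 : 1 ≤ l) (hl : 2 * l ≤ r) (hm : r + l * m ≤ t) (hη : 4 * (l : ℝ) ^ 2 / r < 1)
    (hM : 0 < (m : ℝ) ^ l *
      ((1 - 2 * (l : ℝ) / r) ^ (t - r) * (2 * t * ((f t : ℝ) / (2 * t)) ^ l))) :
    2 ≤ (edgeStepLaw f t).toOuterMeasure {G | l ≤ G.diam} +
      ((ENNReal.ofReal ((m : ℝ) ^ l *
        ((1 - 2 * (l : ℝ) / r) ^ (t - r) * (2 * t * ((f t : ℝ) / (2 * t)) ^ l))))⁻¹ +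
      (ENNReal.ofReal (1 - 4 * (l : ℝ) ^ 2 / r))⁻¹) := by
  have hr : 1 ≤ r := by omega
  have hrt : r ≤ t := by omega
  have ht : 1 ≤ t := by omega
  have hat : ∀ a ∈ blockChains l r m, ∀ i, a i ≤ t := fun a ha i =>
    (le_of_mem_blockChains ha i).trans hm
  have hprob : ∀ a ∈ blockChains l r m, ENNReal.ofReal (chainProb f a r t) ≤
      (edgeStepLaw f t).toOuterMeasure {G | PendantChain a t G} := fun a ha =>
    chainProb_le f (blockChains_strictMono ha) hr (by omega) (lt_of_mem_blockChains ha) hrt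
  refine PMF.second_moment (edgeStepLaw f t) (blockChains l r m) (fun a => {G | PendantChain a t G})
    _ ?_ _ _ (ENNReal.ofReal_pos.2 hM).ne' ?_ (fun a => ENNReal.ofReal (chainProb f a r t))
    (by simpa using hη) ENNReal.ofReal_ne_top hprob ?_
  · intro a ha
    rw [PMF.toOuterMeasure_apply_eq_zero_iff, Set.disjoint_left]
    rintro G hG ⟨hC, hd⟩
    refine hd (PendantChain.le_diam (blockChains_strictMono ha) (valid_of_mem_support f ht G hG) hC
      (hat a ha) fun i => ?_)
    have := lt_of_mem_blockChains ha i
    omega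
  · calc ENNReal.ofReal ((m : ℝ) ^ l *
          ((1 - 2 * (l : ℝ) / r) ^ (t - r) * (2 * t * ((f t : ℝ) / (2 * t)) ^ l)))
        = ∑ a ∈ blockChains l r m, ENNReal.ofReal
          ((1 - 2 * (l : ℝ) / r) ^ (t - r) * (2 * t * ((f t : ℝ) / (2 * t)) ^ l)) := by
          rw [Finset.sum_const, card_blockChains, ENNReal.ofReal_mul (by positivity), nsmul_eq_mul,
            ENNReal.ofReal_pow (by positivity), ENNReal.ofReal_natCast, Nat.cast_pow]
      _ ≤ _ := by
          refine Finset.sum_le_sum fun a ha => le_trans (ENNReal.ofReal_le_ofReal ?_) (hprob a ha)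
          exact le_chainProb f (blockChains_strictMono ha) hr hl hl1 (lt_of_mem_blockChains ha)
            (hat a ha) (f t).2.1 fun s hs hst => hf hs ht hst
  · intro a ha b hb hab
    -- Disjoint chains are covered by `pair_le`; distinct chains with a common vertex cannot both be
    -- present.
    by_cases hdisj : ∀ i j, a i ≠ b j
    · exact pair_le f (blockChains_strictMono ha) (blockChains_strictMono hb) hdisj hr hl hrt
    · push Not at hdisj
      obtain ⟨i, j, hij⟩ := hdisj
      have hrank : ∀ i j, a i = b j → i = j := fun i j h =>
        le_antisymm (blockChains_rank ha hb h.le) (blockChains_rank hb ha h.ge)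
      have h0 : (edgeStepLaw f t).toOuterMeasure
          ({G | PendantChain a t G} ∩ {G | PendantChain b t G}) = 0 := by
        rw [PMF.toOuterMeasure_apply_eq_zero_iff, Set.disjoint_left]
        rintro G - ⟨hA, hB⟩
        refine hab (PendantChain.eq_of_meet (blockChains_strictMono ha) hA hB (hat a ha) hrank
          (i₀ := i) ?_)
        rw [hij, hrank i j hij]
      rw [h0, zero_mul]
      exact zero_le

/-! ### Numerical estimates for the expected number of chains. -/

theorem exp_neg_two_mul_le {x : ℝ} (h0 : 0 ≤ x) (h1 : x ≤ 1 / 2) : Real.exp (-(2 * x)) ≤ 1 - x := by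
  rw [Real.exp_neg, inv_le_comm₀ (Real.exp_pos _) (by linarith)]
  have h2 : (1 - x)⁻¹ ≤ 1 + 2 * x := by
    rw [inv_le_iff_one_le_mul₀ (by linarith)]
    nlinarith
  linarith [Real.add_one_le_exp (2 * x)]

/-- A lower bound for the expected number of pendant chains of length `l`. -/
theorem exp_le_expected {t l : ℕ} {p : ℝ} (hp : 0 < p) (hl1 : 1 ≤ l) (hlt : 16 * l ≤ t) :
    Real.exp (Real.log t - l * (-Real.log p + Real.log l + 7)) ≤
      ((t / 2 / l : ℕ) : ℝ) ^ l * ((1 - 2 * (l : ℝ) / (t - t / 2 : ℕ)) ^ (t - (t - t / 2)) *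
        (2 * t * (p / (2 * t)) ^ l)) := by
  set q := t / 2 with hq
  set r := t - q with hr
  set m := q / l with hm
  have hqr : t - r = q := by omega
  have hl0 : (0 : ℝ) < l := by exact_mod_cast hl1
  have ht0 : (0 : ℝ) < t := by exact_mod_cast (by omega : 0 < t)
  have hr0 : (0 : ℝ) < r := by exact_mod_cast (by omega : 0 < r)
  have hm8 : (t : ℝ) / (8 * l) ≤ m := by
    have h1 : 1 ≤ m := (Nat.one_le_div_iff (by omega)).2 (by omega)
    have h2 : q < (m + 1) * l := by
      have := Nat.lt_div_mul_add (a := q) (show 0 < l by omega)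
      rw [add_mul, one_mul]; exact this
    have h3 : t ≤ m * (8 * l) := by nlinarith [Nat.div_add_mod t 2, Nat.mod_lt t two_pos]
    rw [div_le_iff₀ (by positivity)]
    exact_mod_cast h3
  have hpow : Real.exp (-(4 * l)) ≤ (1 - 2 * (l : ℝ) / r) ^ q := by
    have hx0 : 0 ≤ 2 * (l : ℝ) / r := by positivity
    have hx : 2 * (l : ℝ) / r ≤ 1 / 2 := by
      rw [div_le_iff₀ hr0]
      have : 4 * l ≤ r := by omega
      have : (4 * l : ℝ) ≤ r := by exact_mod_cast this
      linarith
    refine le_trans ?_ (pow_le_pow_left₀ (Real.exp_pos _).le (exp_neg_two_mul_le hx0 hx) q)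
    rw [← Real.exp_nat_mul, Real.exp_le_exp]
    have hqr' : (q : ℝ) ≤ r := by exact_mod_cast (by omega : q ≤ r)
    have : (q : ℝ) * (2 * (2 * l / r)) ≤ 4 * l := by
      have h1 : (q : ℝ) * (2 * (2 * l / r)) = 4 * l * (q / r) := by ring
      rw [h1]
      exact mul_le_of_le_one_right (by positivity) (div_le_one_of_le₀ hqr' hr0.le)
    linarith
  have hlog16 : Real.log 16 ≤ 3 := by
    have h1 : Real.log 16 = 4 * Real.log 2 := by
      rw [show (16 : ℝ) = 2 ^ (4 : ℕ) by norm_num, Real.log_pow]; norm_num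
    linarith [Real.log_two_lt_d9]
  -- The factors combine to `2 * t * (p / (16 * l)) ^ l * exp (-4 * l)`. The constant `7` is `4`
  -- plus the bound `3` for `log 16`, and the leading `2` is dropped.
  have hexp : Real.exp (Real.log t - l * (-Real.log p + Real.log l + 7)) ≤
      (t / (8 * l)) ^ l * (Real.exp (-(4 * l)) * (2 * t * (p / (2 * t)) ^ l)) := by
    have h1 : (t / (8 * l)) ^ l * (Real.exp (-(4 * l)) * (2 * t * (p / (2 * t)) ^ l)) =
        2 * (t * ((p / (16 * l)) ^ l * Real.exp (-(4 * l)))) := by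
      have : (p / (16 * l)) ^ l = (t / (8 * l)) ^ l * (p / (2 * t)) ^ l := by
        rw [← mul_pow]
        congr 1
        field_simp
        norm_num
      rw [this]; ring
    have h2 : Real.exp (Real.log t - l * (-Real.log p + Real.log l + Real.log 16 + 4)) =
        t * ((p / (16 * l)) ^ l * Real.exp (-(4 * l))) := by
      have h3 : (p / (16 * l)) ^ l = Real.exp (l * (Real.log p - (Real.log 16 + Real.log l))) := by
        rw [← Real.log_mul (by norm_num) hl0.ne', ← Real.log_div hp.ne' (by positivity),
          Real.exp_nat_mul, Real.exp_log (by positivity)]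
      rw [h3, ← Real.exp_add, ← Real.exp_log ht0, ← Real.exp_add, Real.log_exp]
      congr 1
      ring
    rw [h1, ← h2]
    have h4 : Real.exp (Real.log t - l * (-Real.log p + Real.log l + 7)) ≤
        Real.exp (Real.log t - l * (-Real.log p + Real.log l + Real.log 16 + 4)) := by
      rw [Real.exp_le_exp]
      have : (l : ℝ) * (Real.log 16) ≤ l * 3 := by gcongr
      linarith
    linarith [Real.exp_pos (Real.log t - l * (-Real.log p + Real.log l + Real.log 16 + 4))]
  rw [hqr]
  refine hexp.trans ?_
  gcongr

/-- The exponent is large for `l = ⌈b⌉`. -/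
theorem exponent_bound {L K b l lam : ℝ} (hK : 26 ≤ K) (hL : 2000 ≤ L) (hKL : Real.log L = K)
    (hlam : 0 ≤ lam)
    (hb1 : 1 < b) (hbK : b * (3 * K) ≤ L) (hbl : 3 * (b * lam) ≤ L) (hl1 : 1 ≤ l) (hlb : l ≤ b + 1) :
    L / 10 ≤ L - l * (lam + Real.log l + 7) ∧ l ≤ L := by
  have hl2 : l ≤ 2 * b := by linarith
  have hlL : l ≤ L := by nlinarith
  refine ⟨?_, hlL⟩
  have hlog0 : 0 ≤ Real.log l := Real.log_nonneg hl1
  -- Rounding `b` up to `l` at most doubles it, which is harmless for small `b`: the `lam` term is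
  -- then at most `2 * L / 3` and the rest is bounded by a constant. For `b ≥ 10` rounding costs a
  -- factor of at most `1.1`, and the two thirds of `L` leave enough room since `7 / K` is small.
  rcases le_total b 10 with h10 | h10
  · have h1 : l * lam ≤ 2 * b * lam := by gcongr
    have h2 : Real.log l ≤ 10 := by linarith [Real.log_le_sub_one_of_pos (by linarith : 0 < l)]
    have h3 : l * (Real.log l + 7) ≤ 11 * (10 + 7) := by gcongr; linarith
    nlinarith
  · have h1 : l ≤ 1.1 * b := by linarith
    have h2 : l * lam ≤ 1.1 * b * lam := by gcongr
    have h3 : Real.log l ≤ K := hKL ▸ Real.log_le_log (by linarith) hlL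
    have h4 : l * (Real.log l + 7) ≤ 1.1 * b * (K + 7) := by gcongr
    nlinarith

/-- Here `l = ⌈b⌉`. The first error term is the inverse of the expected number of chains, at least
`exp (log t / 10)`. The second is the correlation correction, using `l ≤ log t` and `t ≤ 2 * r`. -/
theorem diam_lower_bound (f : ℕ → unitInterval) (hf : AntitoneOn f (Set.Ici 1)) {t : ℕ} {b : ℝ}
    (hK : 26 ≤ Real.log (Real.log t)) (hL : 2000 ≤ Real.log t)
    (hη : 8 * Real.log t ^ 2 / t ≤ 1 / 2) (hf0 : 0 < (f t : ℝ))
    (hb1 : 1 < b) (hbK : b * (3 * Real.log (Real.log t)) ≤ Real.log t)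
    (hbl : 3 * (b * (-Real.log (f t))) ≤ Real.log t) :
    2 - ENNReal.ofReal (Real.exp (-(Real.log t / 10)) + (1 - 8 * Real.log t ^ 2 / t)⁻¹) ≤
      (edgeStepLaw f t).toOuterMeasure {G | b ≤ (G.diam : ℝ)} := by
  have ht0 : (0 : ℝ) < t := by
    rcases Nat.eq_zero_or_pos t with h | h
    · rw [h] at hL; norm_num at hL
    · exact_mod_cast h
  set L := Real.log t with hLdef
  set l := ⌈b⌉₊ with hl
  have hl1 : 1 ≤ l := Nat.one_le_ceil_iff.2 (by linarith)
  have hlb : (l : ℝ) ≤ b + 1 := (Nat.ceil_lt_add_one (by linarith)).le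
  have hlam : 0 ≤ -Real.log (f t) := neg_nonneg.2 (Real.log_nonpos hf0.le (f t).2.2)
  obtain ⟨hexp, hlL⟩ := exponent_bound hK hL rfl hlam hb1 hbK hbl (by exact_mod_cast hl1) hlb
  have hη' : 16 * L ^ 2 ≤ t := by
    rw [div_le_iff₀ ht0] at hη
    linarith
  have hl2 : (l : ℝ) ^ 2 ≤ L ^ 2 := by gcongr
  have hlt : 16 * l ≤ t := by
    have : (16 * l : ℝ) ≤ t := by nlinarith
    exact_mod_cast this
  set r := t - t / 2 with hr
  have hr0 : (0 : ℝ) < r := by exact_mod_cast (by omega : 0 < r)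
  have hr2 : (t : ℝ) ≤ 2 * r := by exact_mod_cast (by omega : t ≤ 2 * r)
  have hηr : 4 * (l : ℝ) ^ 2 / r ≤ 8 * L ^ 2 / t := by
    rw [div_le_div_iff₀ hr0 ht0]
    nlinarith [sq_nonneg (l : ℝ)]
  have hM := exp_le_expected hf0 hl1 hlt
  have hM' := (Real.exp_le_exp.2 hexp).trans hM
  have hm : r + l * (t / 2 / l) ≤ t := by
    have := Nat.mul_div_le (t / 2) l
    omega
  have key := diam_second_moment f hf hl1 (by omega) hm (by linarith)
    ((Real.exp_pos _).trans_le hM')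
  rw [tsub_le_iff_right]
  refine key.trans (add_le_add (MeasureTheory.measure_mono fun G hG => ?_) ?_)
  · exact (Nat.le_ceil b).trans (by exact_mod_cast hG)
  · rw [ENNReal.ofReal_add (Real.exp_pos _).le (inv_nonneg.2 (by linarith)), Real.exp_neg,
      ENNReal.ofReal_inv_of_pos (Real.exp_pos _), ENNReal.ofReal_inv_of_pos (by linarith)]
    gcongr

/-! ### The one-vertex event. -/

/-- The probability of having only one vertex. -/
theorem card_eq_one_le (f : ℕ → unitInterval) {t : ℕ} (ht : 1 ≤ t) :
    (edgeStepLaw f t).toOuterMeasure {G | G.verts.card = 1} ≤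
      ENNReal.ofReal (∏ s ∈ Finset.Ico 1 t, (1 - (f (s + 1) : ℝ))) := by
  have h0 : ∀ s, (0 : ℝ) ≤ 1 - f s := fun s => sub_nonneg.2 (f s).2.2
  induction t, ht using Nat.le_induction with
  | base => simpa using PMF.toOuterMeasure_le_one _ _
  | succ t ht ih =>
    rw [Finset.prod_Ico_succ_top ht, ENNReal.ofReal_mul (Finset.prod_nonneg fun s _ => h0 _),
      edgeStepLaw_succ f ht]
    refine (PMF.toOuterMeasure_bind_le _ _ {G | G.verts.card = 1} _
      -- A vertex-step always creates a second vertex, so the coin must choose the edge-step.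
      (ENNReal.ofReal (1 - f (t + 1))) ?_ ?_).trans (mul_le_mul_left ih _)
    · intro G hG _
      have hV := valid_of_mem_support f ht G hG
      have hcard : ∀ u, (G.addVertex (t + 1) u).verts.card ≠ 1 := fun u h => by
        have h1 : t + 1 ∉ G.verts := fun h => by have := (hV.mem_Icc _ h).2; omega
        have h2 := Finset.card_pos.2 ⟨1, hV.one_mem⟩
        have h3 : (insert (t + 1) G.verts).card = 1 := h
        rw [Finset.card_insert_of_notMem h1] at h3
        omega
      rw [step_toOuterMeasure]
      simp only [Set.mem_ofPred_eq, hcard, Set.ofPred_false, MeasureTheory.measure_empty, mul_zero,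
        zero_add]
      refine mul_le_of_le_one_right' ?_
      calc ∑' u, G.attach u * G.attach.toOuterMeasure {v | (G.addEdge u v).verts.card = 1}
          ≤ ∑' u, G.attach u :=
            ENNReal.tsum_le_tsum fun u => mul_le_of_le_one_right' (PMF.toOuterMeasure_le_one _ _)
        _ = 1 := PMF.tsum_coe _
    · intro G hG G' hG' h
      have hV := valid_of_mem_support f ht G hG
      have h2 := Finset.card_pos.2 ⟨1, hV.one_mem⟩
      have h3 : G.verts.card ≤ G'.verts.card := by
        rcases mem_support_step hG' with ⟨u, rfl⟩ | ⟨u, v, rfl⟩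
        · exact Finset.card_le_card (Finset.subset_insert _ _)
        · exact le_rfl
      have h4 : G'.verts.card = 1 := h
      show G.verts.card = 1
      omega

theorem tendsto_card_eq_one (f : ℕ → unitInterval)
    (h : ¬ Summable (fun s : ℕ => (f s : ℝ)) ∨ f 2 = 1) :
    Tendsto (fun t => (edgeStepLaw f t).toOuterMeasure {G | G.verts.card = 1}) atTop (𝓝 0) := by
  have h0 : ∀ s, (0 : ℝ) ≤ 1 - f s := fun s => sub_nonneg.2 (f s).2.2
  suffices Tendsto (fun t => ∏ s ∈ Finset.Ico 1 t, (1 - (f (s + 1) : ℝ))) atTop (𝓝 0) by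
    have h1 := ENNReal.tendsto_ofReal this
    rw [ENNReal.ofReal_zero] at h1
    exact tendsto_of_tendsto_of_tendsto_of_le_of_le' tendsto_const_nhds h1
      (Eventually.of_forall fun _ => zero_le)
      ((eventually_ge_atTop 1).mono fun t ht => card_eq_one_le f ht)
  rcases h with h | h
  -- The product runs over the coins `f 2, f 3, …`, so the series is shifted by two before comparing
  -- `1 - x` with `exp (-x)`.
  · have h1 : ¬ Summable (fun s : ℕ => (f (s + 2) : ℝ)) := fun hs =>
      h ((summable_nat_add_iff (f := fun s => (f s : ℝ)) 2).1 hs)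
    have h2 := (not_summable_iff_tendsto_nat_atTop_of_nonneg fun s => (f (s + 2)).2.1).1 h1
    have h3 : Tendsto (fun t => Real.exp (-∑ s ∈ Finset.range (t - 1), (f (s + 2) : ℝ))) atTop
        (𝓝 0) :=
      Real.tendsto_exp_neg_atTop_nhds_zero.comp (h2.comp (tendsto_sub_atTop_nat 1))
    refine squeeze_zero (fun t => Finset.prod_nonneg fun s _ => h0 _) (fun t => ?_) h3
    rw [Finset.prod_Ico_eq_prod_range, ← Finset.sum_neg_distrib, Real.exp_sum]
    refine Finset.prod_le_prod (fun s _ => h0 _) fun s _ => ?_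
    rw [show 1 + s + 1 = s + 2 by ring]
    linarith [Real.add_one_le_exp (-(f (s + 2) : ℝ))]
  · refine tendsto_const_nhds.congr' ((eventually_ge_atTop 2).mono fun t ht => ?_)
    exact (Finset.prod_eq_zero (Finset.mem_Ico.2 ⟨le_rfl, ht⟩) (by simp [h])).symm

theorem Multigraph.Valid.one_le_diam {s : ℕ} {G : Multigraph} (hG : Valid s G)
    (h : G.verts.card ≠ 1) : 1 ≤ G.diam := by
  have h1 := Finset.card_pos.2 ⟨1, hG.one_mem⟩
  have : Nontrivial G.verts := by
    rw [← Fintype.one_lt_card_iff_nontrivial, Fintype.card_coe]; omega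
  exact Nat.one_le_iff_ne_zero.2 (SimpleGraph.connected_iff_diam_ne_zero.1 hG.connected)

/-! ### Asymptotics and conclusion. -/

theorem diamScale_bounds (f : ℕ → unitInterval) {t : ℕ} (hK : 0 < Real.log (Real.log t))
    (hL : 0 < Real.log t) (h : 0 < diamScale f t) :
    0 < (f t : ℝ) ∧ diamScale f t * Real.log (Real.log t) ≤ Real.log t ∧
      diamScale f t * (-Real.log (f t)) ≤ Real.log t := by
  have hf0 : f t ≠ 0 := fun h0 => by simp [diamScale, h0] at h
  have hpos : 0 < (f t : ℝ) := unitInterval.pos_iff_ne_zero.2 hf0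
  unfold diamScale
  rw [if_neg hf0]
  split_ifs with h1
  · rw [div_mul_cancel₀ _ hK.ne', h1]
    simpa using hL.le
  · have h2 : 0 < -Real.log (f t) :=
      neg_pos.2 (Real.log_neg hpos (unitInterval.lt_one_iff_ne_one.2 h1))
    refine ⟨hpos, ?_, ?_⟩
    · rw [← le_div_iff₀ hK]; exact min_le_left _ _
    · rw [← le_div_iff₀ h2]; exact min_le_right _ _

/-- A lower bound for the probability of a large diameter, which tends to `1`. -/
noncomputable def diamBound (t : ℕ) : ℝ≥0∞ :=
  2 - ENNReal.ofReal (Real.exp (-(Real.log t / 10)) + (1 - 8 * Real.log t ^ 2 / t)⁻¹)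

theorem tendsto_log_natCast : Tendsto (fun t : ℕ => Real.log t) atTop atTop :=
  Real.tendsto_log_atTop.comp tendsto_natCast_atTop_atTop

theorem tendsto_log_sq_div : Tendsto (fun t : ℕ => 8 * Real.log t ^ 2 / t) atTop (𝓝 0) := by
  have h := (Real.tendsto_pow_log_div_mul_add_atTop 1 0 2 one_ne_zero).comp
    (tendsto_natCast_atTop_atTop (R := ℝ))
  have h2 := h.const_mul 8
  rw [mul_zero] at h2
  refine h2.congr fun t => ?_
  simp [mul_div_assoc]

theorem tendsto_diamBound : Tendsto diamBound atTop (𝓝 1) := by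
  have h1 : Tendsto (fun t : ℕ => Real.exp (-(Real.log t / 10))) atTop (𝓝 0) :=
    Real.tendsto_exp_neg_atTop_nhds_zero.comp
      (tendsto_log_natCast.atTop_div_const (by norm_num))
  have h2 : Tendsto (fun t : ℕ => (1 - 8 * Real.log t ^ 2 / t)⁻¹) atTop (𝓝 1) := by
    have := (tendsto_log_sq_div.const_sub 1).inv₀ (by norm_num)
    simpa using this
  have h3 := ENNReal.tendsto_ofReal (h1.add h2)
  rw [zero_add, ENNReal.ofReal_one] at h3
  have h4 := ENNReal.Tendsto.sub (tendsto_const_nhds (x := (2 : ℝ≥0∞)))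
    h3 (Or.inl ENNReal.ofNat_ne_top)
  have h5 : (2 : ℝ≥0∞) - 1 = 1 := by
    rw [← one_add_one_eq_two]; exact ENNReal.add_sub_cancel_right ENNReal.one_ne_top
  rw [h5] at h4
  exact h4

/-- Either the diameter is large with probability close to `1`, or the required lower bound for it
is at most `1`. -/
theorem eventually_diamBound_le (f : ℕ → unitInterval) (hf : AntitoneOn f (Set.Ici 1)) :
    ∀ᶠ t : ℕ in atTop, 1 < (1 / 3 : ℝ) * diamScale f t →
      diamBound t ≤ (edgeStepLaw f t).toOuterMeasure
        {G | (1 / 3 : ℝ) * diamScale f t ≤ (G.diam : ℝ)} := by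
  have h1 := (Real.tendsto_log_atTop.comp tendsto_log_natCast).eventually_ge_atTop 26
  have h2 := tendsto_log_natCast.eventually_ge_atTop 2000
  have h3 := tendsto_log_sq_div.eventually (eventually_le_nhds (show (0 : ℝ) < 1 / 2 by norm_num))
  filter_upwards [h1, h2, h3] with t hK hL hη hb
  simp only [Function.comp_apply] at hK
  obtain ⟨hf0, hbK, hbl⟩ := diamScale_bounds f (by linarith) (by linarith)
    (show 0 < diamScale f t by linarith)
  exact diam_lower_bound f hf hK hL hη hf0 hb (by linarith) (by linarith)

theorem toOuterMeasure_small_scale (f : ℕ → unitInterval) {t : ℕ} (ht : 1 ≤ t)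
    (h : (1 / 3 : ℝ) * diamScale f t ≤ 1) :
    (edgeStepLaw f t).toOuterMeasure
      {G | G.verts.card = 1 ∨ (1 / 3 : ℝ) * diamScale f t ≤ (G.diam : ℝ)} = 1 := by
  rw [PMF.toOuterMeasure_apply_eq_one_iff]
  intro G hG
  by_cases hc : G.verts.card = 1
  · exact Or.inl hc
  · have := (valid_of_mem_support f ht G hG).one_le_diam hc
    exact Or.inr (h.trans (by exact_mod_cast this))

theorem theorem2 (f : ℕ → unitInterval) (hf : AntitoneOn f (Set.Ici 1)) :
    Tendsto (fun t : ℕ => (edgeStepLaw f t).toOuterMeasure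
        {G | G.verts.card = 1 ∨ (1 / 3 : ℝ) * diamScale f t ≤ (G.diam : ℝ)}) atTop (𝓝 1) ∧
    ((¬ Summable (fun s : ℕ => (f s : ℝ))) ∨ f 2 = 1 ∨ (∃ s : ℕ, 1 ≤ s ∧ f s = 0) →
      Tendsto (fun t : ℕ => (edgeStepLaw f t).toOuterMeasure
        {G | (1 / 3 : ℝ) * diamScale f t ≤ (G.diam : ℝ)}) atTop (𝓝 1)) := by
  have first : Tendsto (fun t : ℕ => (edgeStepLaw f t).toOuterMeasure
      {G | G.verts.card = 1 ∨ (1 / 3 : ℝ) * diamScale f t ≤ (G.diam : ℝ)}) atTop (𝓝 1) := by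
    -- The bound is `diamBound t` when the required diameter exceeds `1`, and the probability is
    -- exactly `1` otherwise; the minimum with `1` serves both cases, which may alternate along `t`.
    have hmin := tendsto_diamBound.min (tendsto_const_nhds (x := (1 : ℝ≥0∞)))
    rw [min_self] at hmin
    refine tendsto_of_tendsto_of_tendsto_of_le_of_le' hmin tendsto_const_nhds ?_
      (Eventually.of_forall fun t => PMF.toOuterMeasure_le_one _ _)
    filter_upwards [eventually_diamBound_le f hf, eventually_ge_atTop 1] with t h1 ht
    rcases lt_or_ge 1 ((1 / 3 : ℝ) * diamScale f t) with h | h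
    · exact (min_le_left _ _).trans ((h1 h).trans
        (MeasureTheory.measure_mono fun G hG => Or.inr hG))
    · rw [toOuterMeasure_small_scale f ht h]
      exact min_le_right _ _
  refine ⟨first, fun hcond => ?_⟩
  by_cases hzero : ∃ s : ℕ, 1 ≤ s ∧ f s = 0
  · obtain ⟨s, hs, hfs⟩ := hzero
    refine tendsto_const_nhds.congr' ((eventually_ge_atTop s).mono fun t ht => ?_)
    -- Once `f` vanishes it stays zero, so the scale is `0` and the diameter bound is trivial.
    have hft : f t = 0 := le_antisymm (hfs ▸ hf hs (hs.trans ht) ht) unitInterval.nonneg'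
    symm
    rw [PMF.toOuterMeasure_apply_eq_one_iff]
    intro G _
    simp [diamScale, hft]
  · have hone := tendsto_card_eq_one f ((or_assoc.2 hcond).resolve_right hzero)
    -- The one-vertex event has vanishing probability here, so it can be subtracted from the first
    -- claim.
    have hsub := ENNReal.Tendsto.sub first hone (Or.inl ENNReal.one_ne_top)
    rw [tsub_zero] at hsub
    refine tendsto_of_tendsto_of_tendsto_of_le_of_le hsub tendsto_const_nhds (fun t => ?_)
      fun t => PMF.toOuterMeasure_le_one _ _
    refine tsub_le_iff_left.2 ((MeasureTheory.measure_mono fun G hG => ?_).trans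
      (MeasureTheory.measure_union_le {G : Multigraph | G.verts.card = 1} _))
    exact hG
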